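/- Setting. Let $d,m,K\in\mathbb N$, frequencies $\omega\in\mathbb R^K$, phases $\phi\in\mathbb R^K$. The clock process on $\mathbb C^K$ is the flow $\Phi_t^i=e^{2\pi j\omega_i t}\Phi_0^i$ of $\frac{d}{dt}\Phi_t=W\Phi_t$, $W=2\pi j\,\mathrm{diag}(\omega_i)$. Its state space is $\Omega=\{(e^{2\pi j\phi_i}h_i)_i: h\in H\}$, where $H$ is a closed subgroup of the torus $\{|z|=1\}^K$ containing $(e^{2\pi j\omega_i t})_i$ for all $t\in\mathbb R$ (e.g. $H$ the whole torus, or $H$ the closure of this one-parameter group, in which case $\Omega$ is the closure of the orbit of $(e^{2\pi j[\omega_i t+\phi_i]})_i$); $\pi$ is the uniform probability measure on $\Omega$ (the translate of the normalized Haar measure of $H$), and $\mathsf E$ denotes expectation for $\Phi\sim\pi$. Let $G_0:\mathbb R^K\to\mathbb R^m$ be continuous, $G(z)=G_0((z+1/z)/2)$ and $\xi_t=G(\Phi_t)$. For $f:\mathbb R^d\times\mathbb R^m\to\mathbb R^d$ let $\bar f(\theta)=\mathsf E[f(\theta,G(\Phi))]$, and for a gain $\alpha>0$ consider the QSA ODE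 $\frac{d}{dt}\Theta_t=\alpha f(\Theta_t,\xi_t)$, $t\ge 0$, with arbitrary initial conditions $\Theta_0\in\mathbb R^d$, $\Phi_0\in\Omega$. For $g:\mathbb R^d\times\Omega\to\mathbb R^d$ with mean $\bar g(\theta)=\mathsf E[g(\theta,\Phi)]$, a *smooth normalized solution of Poisson's equation with forcing function $g$* is a function $\hat g$ that is $C^1$ on $\mathbb R^d\times\Omega$, with $\mathsf E[\hat g(\theta,\Phi)]=0$ for each $\theta$, and $\hat g(\theta,\Phi_0)=\hat g(\theta,\Phi_T)+\int_0^T[g(\theta,\Phi_t)-\bar g(\theta)]\,dt$ for all $\theta$, $\Phi_0\in\Omega$, $T\ge0$. Assumptions. (A1) For some $L<\infty$ and all $\theta,\theta',\xi,\xi'$: $\|\bar f(\theta')-\bar f(\theta)\|\le L\|\theta'-\theta\|$ and $\|f(\theta',\xi)-f(\theta,\xi)\|+\|f(\theta,\xi')-f(\theta,\xi)\|\le L[\|\theta'-\theta\|+\|\xi'-\xi\|]$. (A2) $f$ and $\bar f$ are twice continuously differentiable. (A3) There is a smooth normalized solution $\hat f$ of Poisson's equation with forcing function $(\theta,z)\mapsto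 f(\theta,G(z))$; and with $\Upsilon(\theta,z)=-\partial_\theta\hat f(\theta,z)\,f(\theta,G(z))$, there are smooth normalized solutions of Poisson's equation with forcing functions $\hat f$ and $\Upsilon$. Put $\bar\Upsilon(\theta)=\mathsf E[\Upsilon(\theta,\Phi)]$. (A4) $\alpha^0>0$ and the family of QSA ODEs is $\alpha^0$-ultimately bounded: there is $B<\infty$ such that for each $\alpha\in(0,\alpha^0]$, $\Theta_0$ and $\Phi_0$ there is $t_0<\infty$ with $\|\Theta_t\|\le B$ for $t\ge t_0$. The ODE $\frac{d}{dt}\vartheta_t=\bar f(\vartheta_t)$ is globally asymptotically stable with unique equilibrium $\theta^*$, and the matrix $A^*=\partial_\theta\bar f(\theta^*)$ is Hurwitz. Filter. For fixed $\zeta\in(0,1)$, $\eta>0$, and $\gamma=\eta\alpha$, the filtered estimate $\Theta^F$ is any solution on $t\ge0$ (arbitrary initial conditions) of $$\tfrac{d^2}{dt^2}\Theta^F_t+2\gamma\zeta\tfrac{d}{dt}\Theta^F_t+\gamma^2\Theta^F_t=\gamma^2\Theta_t .$$ Theorem. Assume (A1)–(A4). Then: (i) There is a constant $C$ such that for all $0<\alpha\le\alpha^0$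 and all initial conditions, $\|\Theta_t-\theta^*\|\le C\alpha+o(1)$ as $t\to\infty$. (ii) For all fixed $\zeta\in(0,1)$ and $\eta>0$ there are constants $C_1,C_2$ such that for all $0<\alpha\le\alpha^0$, with $\gamma=\eta\alpha$, and all initial conditions, $\|\Theta^F_t-\theta^*\|\le C_1(\alpha\gamma+\alpha^2)+C_2\,\alpha\|\bar\Upsilon(\theta^*)\|+o(1)$ as $t\to\infty$. (iii) Consequently, if $\bar\Upsilon(\theta^*)=0$, then for all fixed $\zeta\in(0,1)$ and $\eta>0$ the asymptotic bias of $\Theta^F$ is $O(\alpha^2)$: there is a constant $B_0$ such that $\limsup_{t\to\infty}\|\Theta^F_t-\theta^*\|\le B_0\alpha^2$ for all $0<\alpha\le\alpha^0$ and all initial conditions. Here the $o(1)$ terms may depend on $\alpha$, on $\gamma,\zeta$ and on the initial conditions, while the constants do not depend on $\alpha$ or on the initial conditions. -/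

import Mathlib

open MeasureTheory Filter Topology Set

noncomputable section

/-- The data of a fixed-gain quasi-stochastic approximation model.

The clock process `Φ` has entries `Φᵢ(t) = exp(2πj(ωᵢ t + φᵢ))`. Its state space `Ω ⊂ ℂᴷ` is a
homogeneous subset of the `K`-torus: the translate, by the phase vector, of a closed subgroup `H`
that contains the one-parameter group of clock rotations. The two standard choices are `H = ⊤`
(`Ω` is the whole torus) and `H` the closure of the one-parameter group (`Ω` is the closure of the
orbit of the clock with phases `φ`). The probing signal is `ξ(t) = G₀(cos(2π(ωᵢ t + φᵢ)))`. -/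
structure QSAModel (d m K : ℕ) where
  /-- frequencies -/
  omega : Fin K → ℝ
  /-- phases -/
  phase : Fin K → ℝ
  /-- the closed subgroup of the torus whose translate is the clock state space -/
  H : Subgroup (Fin K → Circle)
  isClosed_H : IsClosed (H : Set (Fin K → Circle))
  rotation_mem_H : ∀ t : ℝ, (fun i => Circle.exp (2 * Real.pi * (omega i * t))) ∈ H
  /-- the map that produces the probing signal from the sinusoids -/
  G₀ : (Fin K → ℝ) → EuclideanSpace ℝ (Fin m)
  continuous_G₀ : Continuous G₀
  /-- the vector field -/
  f : EuclideanSpace ℝ (Fin d) → EuclideanSpace ℝ (Fin m) → EuclideanSpace ℝ (Fin d)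

namespace QSAModel

variable {d m K : ℕ} (M : QSAModel d m K)

/-- The parametrization of the clock state space by the subgroup `H`. -/
def param (h : M.H) : Fin K → ℂ :=
  fun i => (Circle.exp (2 * Real.pi * M.phase i) : ℂ) * ((h : Fin K → Circle) i : ℂ)

/-- The clock state space `Ω`. -/
def Omega : Set (Fin K → ℂ) := Set.range M.param

/-- The flow of the clock dynamics `dΦ/dt = W Φ`, `W = 2πj diag(ωᵢ)`. -/
def clock (t : ℝ) (z : Fin K → ℂ) : Fin K → ℂ :=
  fun i => Complex.exp (2 * Real.pi * Complex.I * (M.omega i * t)) * z i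

theorem compactSpace_H : CompactSpace M.H :=
  isCompact_iff_compactSpace.mp M.isClosed_H.isCompact

/-- The uniform probability measure `π` on `Ω`: the image of the normalized Haar measure of `H`. -/
def unif : Measure (Fin K → ℂ) :=
  haveI := M.compactSpace_H
  letI : MeasurableSpace M.H := borel M.H
  haveI : BorelSpace M.H := ⟨rfl⟩
  (Measure.haarMeasure (⊤ : TopologicalSpace.PositiveCompacts M.H)).map M.param

/-- `G(z) = G₀((z + 1/z)/2)`; on `Ω` the argument is real. -/
def G (z : Fin K → ℂ) : EuclideanSpace ℝ (Fin m) :=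
  M.G₀ (fun i => ((z i + (z i)⁻¹) / 2).re)

/-- Steady-state mean in the clock variable: `ḡ(θ) = E[g(θ, Φ)]`, `Φ ∼ π`. -/
def mean (g : EuclideanSpace ℝ (Fin d) → (Fin K → ℂ) → EuclideanSpace ℝ (Fin d))
    (θ : EuclideanSpace ℝ (Fin d)) : EuclideanSpace ℝ (Fin d) :=
  ∫ z, g θ z ∂M.unif

/-- The vector field as a function of the clock state, `(θ, z) ↦ f(θ, G(z))`. -/
def fG (θ : EuclideanSpace ℝ (Fin d)) (z : Fin K → ℂ) : EuclideanSpace ℝ (Fin d) :=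
  M.f θ (M.G z)

/-- The mean vector field `f̄(θ) = E[f(θ, G(Φ))]`. -/
def fbar : EuclideanSpace ℝ (Fin d) → EuclideanSpace ℝ (Fin d) := M.mean M.fG

/-- `ĝ` is a continuously differentiable solution on `ℝᵈ × Ω` of Poisson's equation with forcing
function `g`, normalized to have mean zero for each `θ`. -/
structure IsSmoothPoissonSolution
    (g ghat : EuclideanSpace ℝ (Fin d) → (Fin K → ℂ) → EuclideanSpace ℝ (Fin d)) : Prop where
  poisson : ∀ θ, ∀ z ∈ M.Omega, ∀ T : ℝ, 0 ≤ T →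
    ghat θ z = ghat θ (M.clock T z) + ∫ t in (0 : ℝ)..T, (g θ (M.clock t z) - M.mean g θ)
  contDiffOn : ContDiffOn ℝ 1
    (fun p : EuclideanSpace ℝ (Fin d) × (Fin K → ℂ) => ghat p.1 p.2) (Set.univ ×ˢ M.Omega)
  mean_zero : ∀ θ, M.mean ghat θ = 0

/-- `Υ(θ, z) = - ∂_θ f̂(θ, z) · f(θ, G(z))`. -/
def Upsilon (fhat : EuclideanSpace ℝ (Fin d) → (Fin K → ℂ) → EuclideanSpace ℝ (Fin d))
    (θ : EuclideanSpace ℝ (Fin d)) (z : Fin K → ℂ) : EuclideanSpace ℝ (Fin d) :=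
  -(fderiv ℝ (fun θ' => fhat θ' z) θ (M.fG θ z))

/-- `Ῡ(θ) = E[Υ(θ, Φ)]`. -/
def UpsilonBar (fhat : EuclideanSpace ℝ (Fin d) → (Fin K → ℂ) → EuclideanSpace ℝ (Fin d)) :
    EuclideanSpace ℝ (Fin d) → EuclideanSpace ℝ (Fin d) :=
  M.mean (M.Upsilon fhat)

/-- `f` and `f̄` are globally Lipschitz. -/
def LipschitzFields : Prop :=
  ∃ L : ℝ,
    (∀ θ θ', ‖M.fbar θ' - M.fbar θ‖ ≤ L * ‖θ' - θ‖) ∧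
    (∀ θ θ' ξ ξ', ‖M.f θ' ξ - M.f θ ξ‖ + ‖M.f θ ξ' - M.f θ ξ‖ ≤ L * (‖θ' - θ‖ + ‖ξ' - ξ‖))

/-- `f` and `f̄` are twice continuously differentiable. -/
def SmoothFields : Prop :=
  ContDiff ℝ 2 (fun p : EuclideanSpace ℝ (Fin d) × EuclideanSpace ℝ (Fin m) => M.f p.1 p.2) ∧
    ContDiff ℝ 2 M.fbar

/-- `f̂` is a smooth normalized solution of Poisson's equation with forcing function `f`, and there
are smooth normalized solutions for the forcing functions `f̂` and `Υ`. -/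
def PoissonSolvable
    (fhat : EuclideanSpace ℝ (Fin d) → (Fin K → ℂ) → EuclideanSpace ℝ (Fin d)) : Prop :=
  M.IsSmoothPoissonSolution M.fG fhat ∧
    (∃ fhathat, M.IsSmoothPoissonSolution fhat fhathat) ∧
    (∃ Upsilonhat, M.IsSmoothPoissonSolution (M.Upsilon fhat) Upsilonhat)

/-- `Θ` solves, for `t ≥ 0`, the fixed-gain ODE `dΘ/dt = α f(Θ, ξ)`, `ξ(t) = G(Φ(t))`, `Φ(0) = z`. -/
def IsSolution (α : ℝ) (z : Fin K → ℂ) (Θ : ℝ → EuclideanSpace ℝ (Fin d)) : Prop :=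
  ∀ t : ℝ, 0 ≤ t →
    HasDerivWithinAt Θ (α • M.f (Θ t) (M.G (M.clock t z))) (Set.Ici 0) t

/-- `α⁰`-ultimate boundedness of the family of ODEs: one bound `B` serves all gains
`α ∈ (0, α⁰]` and all initial conditions, after a time that may depend on both. -/
def UltimatelyBounded (α₀ : ℝ) : Prop :=
  ∃ B : ℝ, ∀ α : ℝ, 0 < α → α ≤ α₀ → ∀ z ∈ M.Omega, ∀ Θ, M.IsSolution α z Θ →
    ∃ t₀ : ℝ, ∀ t : ℝ, t₀ ≤ t → 0 ≤ t → ‖Θ t‖ ≤ B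

end QSAModel

/-- `x` solves the autonomous ODE `dx/dt = v(x)` for `t ≥ 0`. -/
def IsFlowLine {d : ℕ} (v : EuclideanSpace ℝ (Fin d) → EuclideanSpace ℝ (Fin d))
    (x : ℝ → EuclideanSpace ℝ (Fin d)) : Prop :=
  ∀ t : ℝ, 0 ≤ t → HasDerivWithinAt x (v (x t)) (Set.Ici 0) t

/-- The ODE `dx/dt = v(x)` is globally asymptotically stable with unique equilibrium `θs`. -/
structure IsGloballyAsymptoticallyStable {d : ℕ}
    (v : EuclideanSpace ℝ (Fin d) → EuclideanSpace ℝ (Fin d))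
    (θs : EuclideanSpace ℝ (Fin d)) : Prop where
  unique_equilibrium : ∀ θ, v θ = 0 ↔ θ = θs
  stable : ∀ ε : ℝ, 0 < ε → ∃ δ : ℝ, 0 < δ ∧ ∀ x, IsFlowLine v x → ‖x 0 - θs‖ < δ →
    ∀ t : ℝ, 0 ≤ t → ‖x t - θs‖ < ε
  attractive : ∀ x, IsFlowLine v x → Tendsto x atTop (𝓝 θs)

/-- A real linear map is Hurwitz: all its complex eigenvalues have negative real part. -/
def IsHurwitz {d : ℕ}
    (A : EuclideanSpace ℝ (Fin d) →L[ℝ] EuclideanSpace ℝ (Fin d)) : Prop :=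
  ∀ μ : ℂ, Polynomial.aeval μ
    (A : EuclideanSpace ℝ (Fin d) →ₗ[ℝ] EuclideanSpace ℝ (Fin d)).charpoly = 0 → μ.re < 0

/-- The family of ODEs is `α⁰`-ultimately bounded (with `α⁰ > 0`), the mean flow is globally
asymptotically stable with unique equilibrium `θs`, and its linearization at `θs` is Hurwitz. -/
structure QSAModel.StableFamily {d m K : ℕ} (M : QSAModel d m K) (α₀ : ℝ)
    (θs : EuclideanSpace ℝ (Fin d)) : Prop where
  pos : 0 < α₀
  ultimatelyBounded : M.UltimatelyBounded α₀
  gas : IsGloballyAsymptoticallyStable M.fbar θs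
  hurwitz : IsHurwitz (fderiv ℝ M.fbar θs)

/-- `F` is an output, for `t ≥ 0` and with arbitrary initial conditions, of the second-order filter
`F'' + 2γζ F' + γ² F = γ² Θ` with input `Θ`. -/
def IsFilterOutput {d : ℕ} (γ ζ : ℝ) (Θ F : ℝ → EuclideanSpace ℝ (Fin d)) : Prop :=
  ∃ V : ℝ → EuclideanSpace ℝ (Fin d), ∀ t : ℝ, 0 ≤ t →
    HasDerivWithinAt F (V t) (Set.Ici 0) t ∧
    HasDerivWithinAt V (γ ^ 2 • Θ t - (2 * γ * ζ) • V t - γ ^ 2 • F t) (Set.Ici 0) t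

/-- `u(t) ≤ b + o(1)` as `t → ∞`. -/
def LeUpToVanishing (u : ℝ → ℝ) (b : ℝ) : Prop :=
  ∃ ε : ℝ → ℝ, Tendsto ε atTop (𝓝 0) ∧ ∀ t : ℝ, 0 ≤ t → u t ≤ b + ε t

end

/-! The oscillating ODE is reduced to its mean flow by correctors. Along a trajectory, a solution
`ghat` of Poisson's equation with forcing `g` has derivative α ∂_θ ĝ·f − (g − ḡ); adding a multiple
of it trades an oscillating term for its mean, at the cost of a remainder with one more power of α.

For (i), Y = Θ + α f̂ satisfies Y' = α[f̄(Θ) − αΥ], which is the mean flow at Y with an O(α)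
perturbation. By ultimate boundedness Y starts in a fixed compact set from some time on; global
attraction and Grönwall's inequality bring a weakly perturbed trajectory near θ*, where a quadratic
Lyapunov function of the Hurwitz linearization A keeps it within a multiple of the perturbation. If
α is not small, the ultimate bound alone is O(α).

For (ii), Y = Θ + α f̂ − α² Υ̂ − α² A f̂̂ satisfies Y' = α[A(Y − θ*) − αῩ(Θ) + O(α²)], the Taylor
remainder of f̄ being O(α²) by (i). Replacing Ῡ(Θ) by Ῡ(θ*) needs Ῡ to be locally Lipschitz, which
is not evident because f̂ is only C¹. Invariance of π under the clock makes the solution operator of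
Poisson's equation antisymmetric, whence Ῡ = E[∂_θ f · f̂], where only the C² field f is
differentiated. Linear input-to-state stability then gives Y − θ* = O(α² + α‖Ῡ(θ*)‖).

The one remaining O(α) term of Θ is −α f̂, which is the derivative of α f̂̂ up to O(α²). The filter
answers the derivative of a signal W with a response of size O(γ‖W‖), here O(αγ); an energy estimate
shows this. All constants are uniform because α and γ enter the comparison systems only as time
scales. Part (iii) is the case γ = ηα. -/

/-! ### Quadratic Lyapunov functions of Hurwitz maps -/

section Lyapunov

open scoped Matrix.Norms.Operator in
/-- An explicit Euler step of small size for a Hurwitz matrix is a discrete-time stable matrix. -/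
theorem Matrix.exists_euler_step_pow_norm_le {n : ℕ} (a : Matrix (Fin n) (Fin n) ℂ)
    (ha : ∀ μ ∈ spectrum ℂ a, μ.re < 0) :
    ∃ h : ℝ, 0 < h ∧ ∃ r : ℝ, 0 ≤ r ∧ r < 1 ∧
      ∀ᶠ k : ℕ in atTop, ‖(1 + (h : ℂ) • a) ^ k‖ ≤ r ^ k := by
  rcases isEmpty_or_nonempty (Fin n) with hn | hn
  · refine ⟨1, one_pos, 0, le_rfl, zero_lt_one, Eventually.of_forall fun k => ?_⟩
    rw [Subsingleton.elim ((1 + ((1 : ℝ) : ℂ) • a) ^ k) 0, norm_zero]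
    positivity
  -- |1 + hμ|² = 1 + h(h|μ|² + 2 Re μ), and the bracket is negative for small h > 0. The spectrum is
  -- finite, so one h serves all eigenvalues.
  have hsmall : ∀ μ ∈ spectrum ℂ a, ∀ᶠ h : ℝ in 𝓝[>] 0, ‖1 + (h : ℂ) * μ‖ < 1 := by
    intro μ hμ
    have hre := ha μ hμ
    have h1 : Tendsto (fun h : ℝ => h * Complex.normSq μ + 2 * μ.re) (𝓝[>] 0)
        (𝓝 (0 * Complex.normSq μ + 2 * μ.re)) := by
      refine Tendsto.mono_left ?_ nhdsWithin_le_nhds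
      exact Continuous.tendsto (by fun_prop) 0
    filter_upwards [h1.eventually_lt_const (show _ < (0 : ℝ) by linarith), self_mem_nhdsWithin]
      with h hh hpos
    have hpos : (0 : ℝ) < h := hpos
    have : ‖1 + (h : ℂ) * μ‖ ^ 2 < 1 := by
      rw [← Complex.normSq_eq_norm_sq, Complex.normSq_apply]
      rw [Complex.normSq_apply] at hh
      simp only [Complex.add_re, Complex.one_re, Complex.mul_re, Complex.ofReal_re,
        Complex.ofReal_im, zero_mul, sub_zero, Complex.add_im, Complex.one_im, Complex.mul_im,
        zero_add, add_zero]
      nlinarith [mul_neg_of_pos_of_neg hpos hh]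
    nlinarith [norm_nonneg (1 + (h : ℂ) * μ)]
  have hall : ∀ᶠ h : ℝ in 𝓝[>] 0, ∀ μ ∈ spectrum ℂ a, ‖1 + (h : ℂ) * μ‖ < 1 :=
    ((Matrix.finite_spectrum a).eventually_all).2 hsmall
  obtain ⟨h, hh, hpos⟩ := (hall.and self_mem_nhdsWithin).exists
  have hpos : (0 : ℝ) < h := hpos
  have hspec : ∀ k ∈ spectrum ℂ (1 + (h : ℂ) • a), ‖k‖₊ < 1 := by
    intro k hk
    have h0 : (h : ℂ) ≠ 0 := by exact_mod_cast hpos.ne'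
    have hk1 : k - 1 ∈ spectrum ℂ ((h : ℂ) • a) := by
      rw [← spectrum.add_mem_add_iff (s := 1)]
      simpa using hk
    have hk2 : (h : ℂ)⁻¹ * (k - 1) ∈ spectrum ℂ a := by
      rw [← spectrum.smul_mem_smul_iff (r := Units.mk0 (h : ℂ) h0)]
      simpa [Units.smul_def, mul_inv_cancel_left₀ h0] using hk1
    have := hh _ hk2
    rw [mul_inv_cancel_left₀ h0, add_sub_cancel] at this
    exact_mod_cast this
  have hrad : spectralRadius ℂ (1 + (h : ℂ) • a) < (1 : NNReal) :=
    spectrum.spectralRadius_lt_of_forall_lt_of_nonempty (spectrum.nonempty _) hspec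
  obtain ⟨r, hr1, hr2⟩ := ENNReal.lt_iff_exists_nnreal_btwn.1 hrad
  refine ⟨h, hpos, r, r.2, by exact_mod_cast hr2, ?_⟩
  -- Gelfand's formula: ‖(1 + ha)^k‖^(1/k) tends to the spectral radius, which is below r.
  filter_upwards [(spectrum.pow_nnnorm_pow_one_div_tendsto_nhds_spectralRadius
    (1 + (h : ℂ) • a)).eventually_lt_const hr1, eventually_gt_atTop 0] with k hk hk0
  have hk' := ENNReal.rpow_le_rpow hk.le (show (0 : ℝ) ≤ k by positivity)
  rw [← ENNReal.rpow_mul, one_div, inv_mul_cancel₀ (by positivity), ENNReal.rpow_one,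
    ENNReal.rpow_natCast] at hk'
  exact_mod_cast hk'

variable {d : ℕ}

local notation "E" => EuclideanSpace ℝ (Fin d)

-- The matrix estimate is transported through complexification: `Ψ` is an algebra map, so it
-- commutes with powers, and the real part provides a bounded left inverse `T`, whose norm bound is
-- the constant `C`.
open scoped Matrix.Norms.Operator in
theorem IsHurwitz.exists_euler_step_pow_norm_le {A : E →L[ℝ] E} (hA : IsHurwitz A) :
    ∃ h : ℝ, 0 < h ∧ ∃ C r : ℝ, 0 ≤ r ∧ r < 1 ∧
      ∀ᶠ k : ℕ in atTop, ‖(1 + h • A) ^ k‖ ≤ C * r ^ k := by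
  let b := (EuclideanSpace.basisFun (Fin d) ℝ).toBasis
  let Φ : (E →ₗ[ℝ] E) ≃ₐ[ℝ] Matrix (Fin d) (Fin d) ℝ := LinearMap.toMatrixAlgEquiv b
  let Ψ : (E →L[ℝ] E) →ₐ[ℝ] Matrix (Fin d) (Fin d) ℂ :=
    ((Algebra.ofId ℝ ℂ).mapMatrix.comp Φ.toAlgHom).comp
      (Module.End.toContinuousLinearMap E).symm.toAlgHom
  let T : Matrix (Fin d) (Fin d) ℂ →ₗ[ℝ] (E →L[ℝ] E) :=
    (Module.End.toContinuousLinearMap E).toLinearMap.comp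
      (Φ.symm.toLinearMap.comp (Complex.reLm.mapMatrix))
  have hT : ∀ B, T (Ψ B) = B := by
    intro B
    have : (Complex.reLm.mapMatrix ((Algebra.ofId ℝ ℂ).mapMatrix (Φ (B : E →ₗ[ℝ] E)))) =
        Φ (B : E →ₗ[ℝ] E) := by
      ext i j
      simp [Algebra.ofId_apply]
    change (Module.End.toContinuousLinearMap E) (Φ.symm
      (Complex.reLm.mapMatrix ((Algebra.ofId ℝ ℂ).mapMatrix (Φ (B : E →ₗ[ℝ] E))))) = B
    rw [this, Φ.symm_apply_apply]
    ext x
    rfl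
  have hspec : ∀ μ ∈ spectrum ℂ (Ψ A), μ.re < 0 := by
    intro μ hμ
    rw [Matrix.mem_spectrum_iff_isRoot_charpoly] at hμ
    apply hA
    have h1 : (Ψ A).charpoly = Polynomial.map (algebraMap ℝ ℂ)
        (A : E →ₗ[ℝ] E).charpoly := by
      rw [← LinearMap.charpoly_toMatrix (A : E →ₗ[ℝ] E) b, ← Matrix.charpoly_map]
      rfl
    rw [h1, Polynomial.IsRoot.def, Polynomial.eval_map_algebraMap] at hμ
    exact hμ
  obtain ⟨h, hpos, r, hr0, hr1, hev⟩ := Matrix.exists_euler_step_pow_norm_le (Ψ A) hspec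
  obtain ⟨C, hC0, hC⟩ := SemilinearMapClass.bound_of_continuous T T.continuous_of_finiteDimensional
  refine ⟨h, hpos, C, r, hr0, hr1, ?_⟩
  filter_upwards [hev] with k hk
  have h2 : Ψ ((1 + h • A) ^ k) = (1 + (h : ℂ) • Ψ A) ^ k := by
    rw [map_pow, map_add, map_one, map_smul]
    congr 2
  rw [← h2] at hk
  calc ‖(1 + h • A) ^ k‖ = ‖T (Ψ ((1 + h • A) ^ k))‖ := by rw [hT]
    _ ≤ C * ‖Ψ ((1 + h • A) ^ k)‖ := hC _
    _ ≤ _ := by gcongr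

/-- Lyapunov's theorem: a Hurwitz linear map has a quadratic Lyapunov function. -/
theorem IsHurwitz.exists_lyapunov {A : E →L[ℝ] E} (hA : IsHurwitz A) :
    ∃ P : E →L[ℝ] E, (∀ x y, inner ℝ (P x) y = inner ℝ x (P y)) ∧
      (∀ x, ‖x‖ ^ 2 ≤ inner ℝ (P x) x) ∧
      ∃ c : ℝ, 0 < c ∧ ∀ x, inner ℝ (P x) (A x) ≤ -c * ‖x‖ ^ 2 := by
  obtain ⟨h, hpos, C, r, hr0, hr1, hev⟩ := hA.exists_euler_step_pow_norm_le
  set B := 1 + h • A with hB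
  -- P = Σ (Bᵏ)*Bᵏ solves the discrete Lyapunov equation P = 1 + B*PB. Its k = 0 term gives P ≥ 1;
  -- expanding B = 1 + hA gives 2h⟨Px, Ax⟩ = −‖x‖² − h²⟨PAx, Ax⟩, hence the rate 1/(2h).
  let q : ℕ → E →L[ℝ] E := fun k => (ContinuousLinearMap.adjoint (B ^ k)).comp (B ^ k)
  have hq : Summable q := by
    have hg : Summable fun k : ℕ => C ^ 2 * (r ^ 2) ^ k :=
      (summable_geometric_of_lt_one (by positivity) (by nlinarith)).mul_left _
    refine summable_of_isBigO_nat hg (Asymptotics.IsBigO.of_bound 1 ?_)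
    filter_upwards [hev] with k hk
    calc ‖q k‖ ≤ ‖ContinuousLinearMap.adjoint (B ^ k)‖ * ‖B ^ k‖ :=
          ContinuousLinearMap.opNorm_comp_le _ _
      _ = ‖B ^ k‖ ^ 2 := by rw [LinearIsometryEquiv.norm_map]; ring
      _ ≤ (C * r ^ k) ^ 2 := by gcongr
      _ = C ^ 2 * (r ^ 2) ^ k := by ring
      _ ≤ 1 * ‖C ^ 2 * (r ^ 2) ^ k‖ := by rw [one_mul]; exact le_abs_self _
  have hinner : ∀ x y, HasSum (fun k => inner ℝ ((B ^ k) x) ((B ^ k) y))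
      (inner ℝ ((∑' k, q k) x) y) := by
    intro x y
    have h1 : HasSum (fun k => q k x) ((∑' k, q k) x) :=
      hq.hasSum.mapL (ContinuousLinearMap.apply ℝ E x)
    have h2 := h1.mapL (innerSL ℝ y)
    simp only [q, ContinuousLinearMap.comp_apply, innerSL_apply_apply,
      ContinuousLinearMap.adjoint_inner_right] at h2
    simpa only [real_inner_comm] using h2
  refine ⟨∑' k, q k, fun x y => ?_, fun x => ?_, (2 * h)⁻¹, by positivity, fun x => ?_⟩
  · rw [real_inner_comm _ x]
    refine (hinner x y).unique ?_
    simpa only [real_inner_comm] using hinner y x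
  · have := (hinner x x)
    have h0 := this.summable.sum_le_tsum {0} (fun k _ => real_inner_self_nonneg)
    rw [this.tsum_eq] at h0
    simpa using h0
  · set P := ∑' k, q k
    have hnn : ∀ y, 0 ≤ inner ℝ (P y) y := fun y =>
      (hinner y y).nonneg (fun k => real_inner_self_nonneg)
    have hstep : inner ℝ (P x) x = ‖x‖ ^ 2 + inner ℝ (P (B x)) (B x) := by
      have h1 := (hinner x x).tsum_eq
      have h2 := (hinner (B x) (B x)).tsum_eq
      rw [(hinner x x).summable.tsum_eq_zero_add] at h1
      rw [← h1, ← h2]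
      simp [pow_succ]
    have hsymm : inner ℝ (P (A x)) x = inner ℝ (P x) (A x) := by
      refine (hinner _ _).unique ?_
      simpa only [real_inner_comm] using hinner x (A x)
    have hBx : B x = x + h • A x := by simp [hB]
    rw [hBx, map_add, map_smul, inner_add_left, inner_add_right, inner_add_right,
      real_inner_smul_left, real_inner_smul_left, real_inner_smul_right, real_inner_smul_right,
      hsymm] at hstep
    have h3 := hnn (A x)
    have h4 : 2 * h * inner ℝ (P x) (A x) ≤ -‖x‖ ^ 2 := by nlinarith [mul_nonneg hpos.le (mul_nonneg hpos.le h3)]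
    rw [neg_mul, inv_mul_eq_div, le_neg, div_le_iff₀ (by positivity)]
    linarith

end Lyapunov

/-! ### Scalar differential inequalities -/

section ScalarComparison

variable {v v' : ℝ → ℝ} {a β ρ t₀ : ℝ}

/-- The product exp(a(s − t₀))(v(s) − β/a) has nonpositive right derivative. -/
theorem le_exp_add_of_deriv_right_le (ha : 0 < a) (hc : ContinuousOn v (Ici t₀))
    (hd : ∀ t, t₀ ≤ t → HasDerivWithinAt v (v' t) (Ici t) t)
    (hle : ∀ t, t₀ ≤ t → v' t ≤ -a * v t + β) {t : ℝ} (ht : t₀ ≤ t) :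
    v t ≤ (v t₀ - β / a) * Real.exp (-a * (t - t₀)) + β / a := by
  have hE : ∀ s, HasDerivAt (fun s => Real.exp (a * (s - t₀))) (Real.exp (a * (s - t₀)) * a) s := by
    intro s
    have : HasDerivAt (fun s => a * (s - t₀)) a s := by
      simpa using ((hasDerivAt_id s).sub_const t₀).const_mul a
    exact this.exp
  have key : Real.exp (a * (t - t₀)) * (v t - β / a) ≤ v t₀ - β / a := by
    refine image_le_of_deriv_right_le_deriv_boundary
      (f := fun s => Real.exp (a * (s - t₀)) * (v s - β / a))
      (f' := fun s => Real.exp (a * (s - t₀)) * a * (v s - β / a) +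
        Real.exp (a * (s - t₀)) * v' s)
      (B := fun _ => v t₀ - β / a) (B' := fun _ => 0) (a := t₀) (b := t)
      ?_ ?_ (by simp) continuousOn_const (fun _ _ => hasDerivWithinAt_const _ _ _) ?_
      ⟨ht, le_rfl⟩
    · refine ContinuousOn.mul (by fun_prop) ?_
      exact (hc.mono Icc_subset_Ici_self).sub continuousOn_const
    · intro s hs
      exact (hE s).hasDerivWithinAt.mul ((hd s hs.1).sub_const _)
    · intro s hs
      have h1 := hle s hs.1
      have h2 := Real.exp_pos (a * (s - t₀))
      have h3 : a * (v s - β / a) + v' s ≤ 0 := by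
        rw [mul_sub, mul_div_cancel₀ _ ha.ne']
        linarith
      nlinarith
  have h4 : Real.exp (-a * (t - t₀)) * Real.exp (a * (t - t₀)) = 1 := by
    rw [← Real.exp_add]; simp
  have h5 := mul_le_mul_of_nonneg_left key (Real.exp_pos (-a * (t - t₀))).le
  rw [← mul_assoc, h4, one_mul] at h5
  linarith

/-- The factor 2 leaves room β/a > 0 for the decaying exponential, so the bound holds exactly from
some time on rather than up to o(1). -/
theorem eventually_le_of_deriv_right_le (ha : 0 < a) (hβ : 0 < β) (hc : ContinuousOn v (Ici t₀))
    (hd : ∀ t, t₀ ≤ t → HasDerivWithinAt v (v' t) (Ici t) t)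
    (hle : ∀ t, t₀ ≤ t → v' t ≤ -a * v t + β) :
    ∀ᶠ t in atTop, v t ≤ 2 * (β / a) := by
  have h1 : Tendsto (fun t => (v t₀ - β / a) * Real.exp (-a * (t - t₀))) atTop (𝓝 0) := by
    rw [← mul_zero (v t₀ - β / a)]
    refine Tendsto.const_mul _ (Real.tendsto_exp_atBot.comp ?_)
    refine Tendsto.const_mul_atTop_of_neg (by linarith) ?_
    exact tendsto_atTop_add_const_right _ _ tendsto_id
  filter_upwards [h1.eventually_lt_const (div_pos hβ ha), eventually_ge_atTop t₀] with t h2 h3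
  have := le_exp_add_of_deriv_right_le ha hc hd hle h3
  linarith

/-- A sublevel set on whose boundary the derivative is negative is forward invariant. -/
theorem le_of_deriv_right_le_of_le (hβ : β < a * ρ) (hc : ContinuousOn v (Ici t₀))
    (hd : ∀ t, t₀ ≤ t → HasDerivWithinAt v (v' t) (Ici t) t)
    (hle : ∀ t, t₀ ≤ t → v t ≤ ρ → v' t ≤ -a * v t + β) (h0 : v t₀ ≤ ρ) {t : ℝ} (ht : t₀ ≤ t) :
    v t ≤ ρ := by
  refine image_le_of_deriv_right_lt_deriv_boundary' (f := v) (f' := v') (B := fun _ => ρ)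
    (B' := fun _ => 0) (a := t₀) (b := t) (hc.mono Icc_subset_Ici_self) (fun s hs => hd s hs.1) h0
    continuousOn_const (fun _ _ => hasDerivWithinAt_const _ _ _) ?_ ⟨ht, le_rfl⟩
  intro s hs h
  have := hle s hs.1 h.le
  rw [h] at this
  linarith

end ScalarComparison

/-! ### Input-to-state stability, linear and local -/

section InputToState

variable {d : ℕ}

local notation "E" => EuclideanSpace ℝ (Fin d)

/-- A Lyapunov pair `(P, c)` for `A`, with an upper bound `p ≥ 1` for `P`, dissipates small
multiplicative and bounded additive perturbations. -/
theorem lyapunov_dissipation {A P : E →L[ℝ] E} {c p b : ℝ} (hc : 0 < c) (hp : 1 ≤ p)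
    (hPp : ‖P‖ ≤ p) (hPA : ∀ x, inner ℝ (P x) (A x) ≤ -c * ‖x‖ ^ 2) {x w : E}
    (hw : ‖w‖ ≤ c / (2 * p) * ‖x‖ + b) :
    2 * inner ℝ (P x) (A x + w) ≤ -(c / (2 * p)) * inner ℝ (P x) x + 2 * p ^ 2 * b ^ 2 / c := by
  have hp0 : 0 < p := by linarith
  have h1 : ‖P x‖ ≤ p * ‖x‖ := (P.le_opNorm x).trans (by gcongr)
  have h2 : inner ℝ (P x) w ≤ p * ‖x‖ * (c / (2 * p) * ‖x‖ + b) :=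
    (real_inner_le_norm _ _).trans (by gcongr)
  have h3 : inner ℝ (P x) x ≤ p * ‖x‖ ^ 2 :=
    (real_inner_le_norm _ _).trans (by nlinarith [norm_nonneg x])
  have h4 : c / (2 * p) * inner ℝ (P x) x ≤ c / 2 * ‖x‖ ^ 2 := by
    calc c / (2 * p) * inner ℝ (P x) x ≤ c / (2 * p) * (p * ‖x‖ ^ 2) := by gcongr
      _ = c / 2 * ‖x‖ ^ 2 := by field_simp
  have h5 : p * ‖x‖ * (c / (2 * p) * ‖x‖ + b) = c / 2 * ‖x‖ ^ 2 + p * ‖x‖ * b := by field_simp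
  have h6 : 2 * (p * ‖x‖ * b) ≤ c / 2 * ‖x‖ ^ 2 + 2 * p ^ 2 * b ^ 2 / c := by
    have : c / 2 * ‖x‖ ^ 2 + 2 * p ^ 2 * b ^ 2 / c - 2 * (p * ‖x‖ * b) =
        (c * ‖x‖ - 2 * p * b) ^ 2 / (2 * c) := by field_simp; ring
    have : 0 ≤ (c * ‖x‖ - 2 * p * b) ^ 2 / (2 * c) := by positivity
    linarith
  rw [inner_add_right]
  have := hPA x
  linarith

theorem hasDerivWithinAt_inner_self {P : E →L[ℝ] E} (hP : ∀ x y, inner ℝ (P x) y = inner ℝ x (P y))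
    {x : ℝ → E} {x' : E} {s : Set ℝ} {t : ℝ} (hx : HasDerivWithinAt x x' s t) :
    HasDerivWithinAt (fun t => inner ℝ (P (x t)) (x t)) (2 * inner ℝ (P (x t)) x') s t := by
  have h1 : HasDerivWithinAt (fun t => P (x t)) (P x') s t := P.hasFDerivAt.comp_hasDerivWithinAt t hx
  have h2 := h1.inner ℝ hx
  rwa [hP x', real_inner_comm, ← two_mul, real_inner_comm] at h2

/-- Input-to-state stability of a Hurwitz linear system, uniformly in the time scale. -/
theorem IsHurwitz.eventually_norm_le {A : E →L[ℝ] E} (hA : IsHurwitz A) :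
    ∃ C : ℝ, 0 < C ∧ ∀ (γ b t₀ : ℝ) (x w : ℝ → E), 0 < γ → 0 < b →
      (∀ t, t₀ ≤ t → HasDerivWithinAt x (γ • (A (x t) + w t)) (Ici t₀) t) →
      (∀ t, t₀ ≤ t → ‖w t‖ ≤ b) → ∀ᶠ t in atTop, ‖x t‖ ≤ C * b := by
  obtain ⟨P, hsymm, hpos, c, hc, hPA⟩ := hA.exists_lyapunov
  set p := ‖P‖ + 1
  have hp : 1 ≤ p := by simp [p]
  have hPp : ‖P‖ ≤ p := by simp [p]
  -- The comparison bound is 8p³(b/c)² for ⟨Px, x⟩ ≥ ‖x‖²; since p ≥ 1 this is at most (4p²b/c)².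
  refine ⟨4 * p ^ 2 / c, by positivity, fun γ b t₀ x w hγ hb hx hw => ?_⟩
  have hV := fun t ht => hasDerivWithinAt_inner_self hsymm (hx t ht)
  have h1 := eventually_le_of_deriv_right_le (t₀ := t₀) (a := γ * (c / (2 * p)))
    (β := γ * (2 * p ^ 2 * b ^ 2 / c)) (v := fun t => inner ℝ (P (x t)) (x t)) (by positivity)
    (by positivity) (fun t ht => (hV t ht).continuousWithinAt)
    (fun t ht => (hV t ht).mono (Ici_subset_Ici.2 ht)) (fun t ht => ?_)
  · filter_upwards [h1] with t ht
    have h2 := (hpos (x t)).trans ht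
    refine le_of_abs_le (abs_le_of_sq_le_sq (h2.trans ?_) (by positivity))
    have : 2 * (γ * (2 * p ^ 2 * b ^ 2 / c) / (γ * (c / (2 * p)))) = 8 * p ^ 3 * (b / c) ^ 2 := by
      field_simp; ring
    rw [this, show (4 * p ^ 2 / c * b) ^ 2 = 16 * (p ^ 3 * p) * (b / c) ^ 2 by ring]
    gcongr ?_ * _
    nlinarith [pow_pos (zero_lt_one.trans_le hp) 3]
  · have := lyapunov_dissipation hc hp hPp hPA (x := x t) (w := w t) (b := b)
      ((hw t ht).trans (by have : 0 ≤ c / (2 * p) * ‖x t‖ := by positivity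
                           linarith))
    rw [real_inner_smul_right]
    nlinarith

/-- Local input-to-state stability near an equilibrium with Hurwitz linearization. -/
theorem IsHurwitz.eventually_norm_sub_le {v : E → E} {A : E →L[ℝ] E} {θs : E} (hA : IsHurwitz A)
    (hv : HasFDerivAt v A θs) (h0 : v θs = 0) :
    ∃ δ ε C : ℝ, 0 < δ ∧ 0 < ε ∧ 0 < C ∧ ∀ (γ b t₀ : ℝ) (y w : ℝ → E), 0 < γ → 0 < b → b ≤ ε →
      (∀ t, t₀ ≤ t → HasDerivWithinAt y (γ • (v (y t) + w t)) (Ici t₀) t) →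
      (∀ t, t₀ ≤ t → ‖w t‖ ≤ b) → ‖y t₀ - θs‖ ≤ δ → ∀ᶠ t in atTop, ‖y t - θs‖ ≤ C * b := by
  obtain ⟨P, hsymm, hpos, c, hc, hPA⟩ := hA.exists_lyapunov
  set p := ‖P‖ + 1
  have hp : 1 ≤ p := by simp [p]
  have hp0 : 0 < p := by linarith
  have hPp : ‖P‖ ≤ p := by simp [p]
  have hlin : ∀ᶠ θ in 𝓝 θs, ‖v θ - A (θ - θs)‖ ≤ c / (2 * p) * ‖θ - θs‖ := by
    have := (hasFDerivAt_iff_isLittleO.1 hv).def (show 0 < c / (2 * p) by positivity)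
    simpa [h0] using this
  obtain ⟨r, hr, hball⟩ := Metric.eventually_nhds_iff.1 hlin
  -- The sublevel set ⟨Px, x⟩ ≤ ρ = pδ² contains the δ-ball and, as ρ = r²/(4p) < r², lies in the
  -- r-ball where the linearization error is dominated.
  set δ := r / (2 * p)
  have hδ : 0 < δ := by positivity
  set ρ := p * δ ^ 2
  have hρ : 0 < ρ := by positivity
  have hρr : ∀ x : E, inner ℝ (P x) x ≤ ρ → ‖x‖ < r := by
    intro x hx
    have h1 := (hpos x).trans hx
    refine lt_of_pow_lt_pow_left₀ 2 hr.le (h1.trans_lt ?_)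
    have : ρ = r ^ 2 / (4 * p) := by simp only [ρ, δ]; field_simp; ring
    rw [this, div_lt_iff₀ (by positivity)]
    nlinarith [pow_pos hr 2]
  -- For b ≤ ε the input term is at most cδ²/8, below the dissipation cδ²/2 on the boundary of the
  -- sublevel set, so the set is forward invariant.
  set ε := c * δ / (4 * p)
  refine ⟨δ, ε, 4 * p ^ 2 / c, hδ, by positivity, by positivity,
    fun γ b t₀ y w hγ hb hbε hy hw hy0 => ?_⟩
  have hV := fun t ht => hasDerivWithinAt_inner_self hsymm ((hy t ht).sub_const θs)
  have hVle : ∀ t, t₀ ≤ t → inner ℝ (P (y t - θs)) (y t - θs) ≤ ρ →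
      2 * inner ℝ (P (y t - θs)) (γ • (v (y t) + w t)) ≤
        -(γ * (c / (2 * p))) * inner ℝ (P (y t - θs)) (y t - θs) +
          γ * (2 * p ^ 2 * b ^ 2 / c) := by
    intro t ht hle
    have h1 := hball (y := y t) (by rw [dist_eq_norm]; exact hρr _ hle)
    have h2 := lyapunov_dissipation hc hp hPp hPA (x := y t - θs)
      (w := (v (y t) - A (y t - θs)) + w t) (b := b)
      ((norm_add_le _ _).trans (add_le_add h1 (hw t ht)))
    rw [← add_assoc, add_sub_cancel] at h2
    rw [real_inner_smul_right]
    nlinarith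
  have hinv : ∀ t, t₀ ≤ t → inner ℝ (P (y t - θs)) (y t - θs) ≤ ρ := fun t ht =>
    le_of_deriv_right_le_of_le (a := γ * (c / (2 * p))) (β := γ * (2 * p ^ 2 * b ^ 2 / c))
      (v := fun t => inner ℝ (P (y t - θs)) (y t - θs)) (by
        have h1 : b ^ 2 ≤ ε ^ 2 := by gcongr
        have h2 : 2 * p ^ 2 * b ^ 2 / c < c / (2 * p) * ρ := by
          calc 2 * p ^ 2 * b ^ 2 / c ≤ 2 * p ^ 2 * ε ^ 2 / c := by gcongr
            _ = c * δ ^ 2 / 8 := by simp only [ε]; field_simp; ring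
            _ < c * δ ^ 2 / 2 := by
              have : 0 < c * δ ^ 2 := by positivity
              linarith
            _ = c / (2 * p) * ρ := by simp only [ρ]; field_simp
        nlinarith)
      (fun t ht => (hV t ht).continuousWithinAt)
      (fun t ht => (hV t ht).mono (Ici_subset_Ici.2 ht)) hVle (by
        calc inner ℝ (P (y t₀ - θs)) (y t₀ - θs) ≤ ‖P (y t₀ - θs)‖ * ‖y t₀ - θs‖ :=
              real_inner_le_norm _ _
          _ ≤ (p * ‖y t₀ - θs‖) * ‖y t₀ - θs‖ := by
              gcongr
              exact (P.le_opNorm _).trans (by gcongr)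
          _ ≤ (p * δ) * δ := by gcongr
          _ = ρ := by ring) ht
  have h1 := eventually_le_of_deriv_right_le (t₀ := t₀) (a := γ * (c / (2 * p)))
    (β := γ * (2 * p ^ 2 * b ^ 2 / c)) (v := fun t => inner ℝ (P (y t - θs)) (y t - θs))
    (by positivity) (by positivity) (fun t ht => (hV t ht).continuousWithinAt)
    (fun t ht => (hV t ht).mono (Ici_subset_Ici.2 ht)) (fun t ht => hVle t ht (hinv t ht))
  filter_upwards [h1] with t ht
  have h2 := (hpos (y t - θs)).trans ht
  refine le_of_abs_le (abs_le_of_sq_le_sq (h2.trans ?_) (by positivity))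
  have : 2 * (γ * (2 * p ^ 2 * b ^ 2 / c) / (γ * (c / (2 * p)))) = 8 * p ^ 3 * (b / c) ^ 2 := by
    field_simp; ring
  rw [this, show (4 * p ^ 2 / c * b) ^ 2 = 16 * (p ^ 3 * p) * (b / c) ^ 2 by ring]
  gcongr ?_ * _
  nlinarith [pow_pos (zero_lt_one.trans_le hp) 3]

end InputToState

/-! ### Global existence for the mean flow -/

section GlobalFlow

variable {V : Type*} [NormedAddCommGroup V] [NormedSpace ℝ V] [CompleteSpace V]

open scoped Manifold in
/-- A globally Lipschitz `C¹` vector field has a global integral curve through every point. -/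
theorem LipschitzWith.exists_hasDerivAt_eq {v : V → V} {K : NNReal} (hK : LipschitzWith K v)
    (hv : ContDiff ℝ 1 v) (x₀ : V) :
    ∃ x : ℝ → V, x 0 = x₀ ∧ ∀ t, HasDerivAt x (v (x t)) t := by
  -- On the ball of radius ‖v z‖ + 1 about z the speed is at most (K + 1)(‖v z‖ + 1). The guaranteed
  -- lifespan thus does not depend on z, which is what allows continuation to all times.
  set ε : ℝ := 1 / (2 * (K + 1)) with hε
  have hεpos : 0 < ε := by positivity
  have hloc : ∀ z : V, ∃ γ : ℝ → V, γ 0 = z ∧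
      IsMIntegralCurveOn (I := 𝓘(ℝ, V)) γ v (Ioo (-ε) ε) := by
    intro z
    have hpl : IsPicardLindelof (fun _ => v) (tmin := -ε) (tmax := ε)
        ⟨0, by simp [hεpos.le]⟩ z (‖v z‖₊ + 1) 0 (‖v z‖₊ + K * (‖v z‖₊ + 1)) K := by
      refine IsPicardLindelof.of_time_independent ?_ hK.lipschitzOnWith ?_
      · intro x hx
        have h1 := hK.dist_le_mul x z
        have h2 : dist x z ≤ ‖v z‖ + 1 := by simpa using hx
        have h3 : ‖v x‖ ≤ ‖v z‖ + dist (v x) (v z) := by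
          rw [dist_eq_norm]
          simpa using norm_add_le (v z) (v x - v z)
        push_cast
        have h4 : (K : ℝ) * dist x z ≤ K * (‖v z‖ + 1) := by gcongr
        linarith
      · have hn := norm_nonneg (v z)
        have hKn : (0 : ℝ) ≤ K := K.2
        simp only [sub_zero, zero_sub, neg_neg, max_self, NNReal.coe_add, NNReal.coe_mul,
          coe_nnnorm, NNReal.coe_one, NNReal.coe_zero, hε]
        rw [mul_one_div, div_le_iff₀ (by positivity)]
        nlinarith [mul_nonneg hn hKn]
    obtain ⟨γ, h0, hγ⟩ := hpl.exists_eq_forall_mem_Icc_hasDerivWithinAt₀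
    refine ⟨γ, h0, fun t ht => ?_⟩
    exact ((hγ t (Ioo_subset_Icc_self ht)).mono Ioo_subset_Icc_self).hasFDerivWithinAt
      |>.hasMFDerivWithinAt
  obtain ⟨x, h0, hx⟩ := exists_isMIntegralCurve_of_isMIntegralCurveOn (I := 𝓘(ℝ, V)) (v := v)
    (contMDiff_vectorSpace_iff_contDiff.2 hv) hεpos hloc x₀
  refine ⟨x, h0, fun t => ?_⟩
  rw [hasDerivAt_iff_hasFDerivAt]
  exact HasMFDerivAt.hasFDerivAt (hx t)

end GlobalFlow

/-! ### Perturbations of a globally attractive flow -/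

section Attraction

variable {d : ℕ}

local notation "E" => EuclideanSpace ℝ (Fin d)

/-- Perturbed trajectories that start in a compact set visit any given neighbourhood of a globally
attractive equilibrium, if the perturbation is small. -/
theorem IsCompact.exists_norm_sub_le_of_attractive {v : E → E} {θs : E} {K : NNReal}
    (hK : LipschitzWith K v) (hv : ContDiff ℝ 1 v)
    (hattr : ∀ x, IsFlowLine v x → Tendsto x atTop (𝓝 θs)) {S : Set E} (hS : IsCompact S)
    {δ : ℝ} (hδ : 0 < δ) :
    ∃ ε : ℝ, 0 < ε ∧ ∀ (γ t₀ : ℝ) (y w : ℝ → E), 0 < γ → y t₀ ∈ S →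
      (∀ t, t₀ ≤ t → HasDerivWithinAt y (γ • (v (y t) + w t)) (Ici t₀) t) →
      (∀ t, t₀ ≤ t → ‖w t‖ ≤ ε) → ∃ t₁, t₀ ≤ t₁ ∧ ‖y t₁ - θs‖ ≤ δ := by
  refine hS.induction_on (p := fun S => ∃ ε : ℝ, 0 < ε ∧ ∀ (γ t₀ : ℝ) (y w : ℝ → E), 0 < γ →
    y t₀ ∈ S → (∀ t, t₀ ≤ t → HasDerivWithinAt y (γ • (v (y t) + w t)) (Ici t₀) t) →
      (∀ t, t₀ ≤ t → ‖w t‖ ≤ ε) → ∃ t₁, t₀ ≤ t₁ ∧ ‖y t₁ - θs‖ ≤ δ) ?_ ?_ ?_ ?_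
  · exact ⟨1, one_pos, fun _ _ _ _ _ h => h.elim⟩
  · rintro s t hst ⟨ε, hε, h⟩
    exact ⟨ε, hε, fun γ t₀ y w hγ hy => h γ t₀ y w hγ (hst hy)⟩
  · rintro s t ⟨ε₁, hε₁, h₁⟩ ⟨ε₂, hε₂, h₂⟩
    refine ⟨min ε₁ ε₂, lt_min hε₁ hε₂, fun γ t₀ y w hγ hy hd hw => ?_⟩
    rcases hy with hy | hy
    · exact h₁ γ t₀ y w hγ hy hd fun t ht => (hw t ht).trans (min_le_left _ _)
    · exact h₂ γ t₀ y w hγ hy hd fun t ht => (hw t ht).trans (min_le_right _ _)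
  intro x₀ _
  obtain ⟨x, hx0, hx⟩ := hK.exists_hasDerivAt_eq hv x₀
  have hlim := hattr x fun t _ => (hx t).hasDerivWithinAt
  obtain ⟨T, hT, hT0⟩ := ((Metric.tendsto_nhds.1 hlim (δ / 2) (half_pos hδ)).and
    (eventually_ge_atTop 0)).exists
  -- Enlarging the Lipschitz constant keeps the Grönwall exponent nonzero.
  set k : ℝ := K + 1
  have hk : 0 < k := by positivity
  set M := Real.exp (k * T) + 1 / k * (Real.exp (k * T) - 1)
  have hM : 0 < M := by
    have : 1 ≤ Real.exp (k * T) := Real.one_le_exp (by positivity)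
    have : 0 ≤ 1 / k * (Real.exp (k * T) - 1) := by
      refine mul_nonneg (by positivity) (by linarith)
    positivity
  -- `M` is the Grönwall amplification over the time T, so an initial error and a perturbation both
  -- of size s produce an error of at most δ/2 there.
  set s := δ / 2 / M
  have hs : 0 < s := by positivity
  refine ⟨Metric.ball x₀ s, mem_nhdsWithin_of_mem_nhds (Metric.ball_mem_nhds _ hs), s, hs,
    fun γ t₀ y w hγ hy hd hw => ⟨t₀ + T / γ, by have : 0 ≤ T / γ := by positivity
                                                linarith, ?_⟩⟩
  -- In the time γ(t − t₀) the gain disappears from the estimate, so s is independent of γ.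
  let z : ℝ → E := fun t => x (γ * (t - t₀))
  have hz : ∀ t, HasDerivAt z (γ • v (z t)) t := by
    intro t
    have h1 : HasDerivAt (fun t => γ * (t - t₀)) γ t := by
      simpa using ((hasDerivAt_id t).sub_const t₀).const_mul γ
    exact (hx (γ * (t - t₀))).scomp t h1
  have hLip : ∀ _ : ℝ, LipschitzWith (γ.toNNReal * (K + 1)) fun θ => γ • v θ := by
    intro _
    refine LipschitzWith.of_dist_le_mul fun a b => ?_
    rw [dist_smul₀, Real.norm_of_nonneg hγ.le, NNReal.coe_mul, Real.coe_toNNReal _ hγ.le, mul_assoc]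
    gcongr
    refine (hK.dist_le_mul a b).trans ?_
    gcongr
    simp
  have hT' : t₀ ≤ t₀ + T / γ := by
    have : 0 ≤ T / γ := by positivity
    linarith
  have hg := dist_le_of_approx_trajectories_ODE (v := fun _ θ => γ • v θ)
    (f := y) (g := z) (f' := fun t => γ • (v (y t) + w t)) (g' := fun t => γ • v (z t))
    (a := t₀) (b := t₀ + T / γ) (εf := γ * s) (εg := 0) (δ := s) hLip
    (fun t ht => ((hd t ht.1).continuousWithinAt).mono Icc_subset_Ici_self)
    (fun t ht => (hd t ht.1).mono (Ici_subset_Ici.2 ht.1))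
    (fun t ht => by
      rw [smul_add, dist_eq_norm, add_sub_cancel_left, norm_smul, Real.norm_of_nonneg hγ.le]
      gcongr
      exact hw t ht.1)
    (fun t _ => (hz t).continuousAt.continuousWithinAt)
    (fun t _ => (hz t).hasDerivWithinAt) (fun t _ => by simp)
    (by simpa [z, hx0] using (Metric.mem_ball.1 hy).le) (t₀ + T / γ) ⟨hT', le_rfl⟩
  have hK' : ((γ.toNNReal * (K + 1) : NNReal) : ℝ) = γ * k := by
    simp [k, hγ.le]
  rw [hK', gronwallBound_of_K_ne_0 (by positivity)] at hg
  have hzT : z (t₀ + T / γ) = x T := by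
    simp only [z]
    congr 1
    field_simp
    ring
  have e1 : γ * k * (t₀ + T / γ - t₀) = k * T := by field_simp; ring
  have e2 : (γ * s + 0) / (γ * k) = s * (1 / k) := by field_simp; ring
  simp only [e1, e2, hzT] at hg
  have e3 : s * Real.exp (k * T) + s * (1 / k) * (Real.exp (k * T) - 1) = δ / 2 := by
    rw [mul_assoc, ← mul_add]
    exact div_mul_cancel₀ _ hM.ne'
  rw [e3] at hg
  calc ‖y (t₀ + T / γ) - θs‖ = dist (y (t₀ + T / γ)) θs := (dist_eq_norm _ _).symm
    _ ≤ dist (y (t₀ + T / γ)) (x T) + dist (x T) θs := dist_triangle _ _ _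
    _ ≤ δ := by linarith

/-- Small perturbations of a globally attracted flow with Hurwitz linearization are ultimately
bounded by a multiple of the size of the perturbation. -/
theorem IsHurwitz.exists_eventually_norm_sub_le_of_attractive {v : E → E} {θs : E} {K : NNReal}
    (hK : LipschitzWith K v) (hv : ContDiff ℝ 1 v) (h0 : v θs = 0)
    (hattr : ∀ x, IsFlowLine v x → Tendsto x atTop (𝓝 θs)) (hA : IsHurwitz (fderiv ℝ v θs))
    {S : Set E} (hS : IsCompact S) :
    ∃ ε C : ℝ, 0 < ε ∧ 0 < C ∧ ∀ (γ b t₀ : ℝ) (y w : ℝ → E), 0 < γ → 0 < b → b ≤ ε → y t₀ ∈ S →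
      (∀ t, t₀ ≤ t → HasDerivWithinAt y (γ • (v (y t) + w t)) (Ici t₀) t) →
      (∀ t, t₀ ≤ t → ‖w t‖ ≤ b) → ∀ᶠ t in atTop, ‖y t - θs‖ ≤ C * b := by
  obtain ⟨δ, ε₁, C, hδ, hε₁, hC, hloc⟩ := hA.eventually_norm_sub_le
    ((hv.differentiable one_ne_zero) θs).hasFDerivAt h0
  obtain ⟨ε₂, hε₂, hent⟩ := hS.exists_norm_sub_le_of_attractive hK hv hattr hδ
  refine ⟨min ε₁ ε₂, C, lt_min hε₁ hε₂, hC, fun γ b t₀ y w hγ hb hbε hy hd hw => ?_⟩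
  obtain ⟨t₁, ht₁, hle⟩ := hent γ t₀ y w hγ hy hd
    fun t ht => (hw t ht).trans (hbε.trans (min_le_right _ _))
  exact hloc γ b t₁ y w hγ hb (hbε.trans (min_le_left _ _))
    (fun t ht => (hd t (ht₁.trans ht)).mono (Ici_subset_Ici.2 ht₁))
    (fun t ht => hw t (ht₁.trans ht)) hle

end Attraction

/-! ### Maps that are C¹ on V × S with S compact -/

section ParameterCalculus

variable {V Z F : Type*} [NormedAddCommGroup V] [NormedSpace ℝ V]
  [NormedAddCommGroup Z] [NormedSpace ℝ Z] [NormedAddCommGroup F] [NormedSpace ℝ F]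
  {S : Set Z} {u : V → Z → F}

/-- The slice through z stays in `univ ×ˢ S`, so a derivative within this set restricts to a genuine
derivative in θ, although S may be too thin to determine derivatives in z. -/
theorem ContDiffOn.hasFDerivAt_partial
    (hu : ContDiffOn ℝ 1 (fun p : V × Z => u p.1 p.2) (univ ×ˢ S)) {θ : V} {z : Z} (hz : z ∈ S) :
    HasFDerivAt (fun θ' => u θ' z) (fderiv ℝ (fun θ' => u θ' z) θ) θ := by
  have h1 := (hu.differentiableOn one_ne_zero (θ, z) ⟨mem_univ _, hz⟩).hasFDerivWithinAt
  have h2 : HasFDerivWithinAt (fun θ' : V => (θ', z)) (ContinuousLinearMap.inl ℝ V Z) univ θ :=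
    (hasFDerivAt_prodMk_left θ z).hasFDerivWithinAt
  have h3 := HasFDerivWithinAt.comp (f := fun θ' : V => (θ', z)) θ h1 h2
    fun _ _ => ⟨mem_univ _, hz⟩
  exact h3.hasFDerivAt_of_univ.differentiableAt.hasFDerivAt

/-- The derivative within the set need not be unique, so a continuous local choice f' is taken from
the definition of C¹; composed with the inclusion of V, it must agree with the partial derivative.
-/
theorem ContDiffOn.continuousOn_fderiv_partial
    (hu : ContDiffOn ℝ 1 (fun p : V × Z => u p.1 p.2) (univ ×ˢ S)) :
    ContinuousOn (fun p : V × Z => fderiv ℝ (fun θ' => u θ' p.2) p.1) (univ ×ˢ S) := by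
  intro x hx
  have h := hu x hx
  rw [← zero_add (1 : WithTop ℕ∞), contDiffWithinAt_succ_iff_hasFDerivWithinAt' (by simp)] at h
  obtain ⟨w, hw, hws, -, f', hf', hcont⟩ := h
  rw [insert_eq_of_mem hx] at hw hws
  have heq : ∀ y ∈ w, fderiv ℝ (fun θ' => u θ' y.2) y.1 =
      (f' y).comp (ContinuousLinearMap.inl ℝ V Z) := by
    intro y hy
    have h2 : HasFDerivWithinAt (fun θ' : V => (θ', y.2)) (ContinuousLinearMap.inl ℝ V Z) univ y.1 :=
      (hasFDerivAt_prodMk_left y.1 y.2).hasFDerivWithinAt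
    have h3 := HasFDerivWithinAt.comp (f := fun θ' : V => (θ', y.2)) y.1 (hf' y hy) h2
      fun _ _ => ⟨mem_univ _, (hws hy).2⟩
    exact h3.hasFDerivAt_of_univ.fderiv
  have hc : ContinuousWithinAt (fun y => (f' y).comp (ContinuousLinearMap.inl ℝ V Z))
      (univ ×ˢ S) x := hcont.continuousWithinAt.clm_comp continuousWithinAt_const
  exact hc.congr_of_eventuallyEq (Filter.mem_of_superset hw heq)
    (heq x (mem_of_mem_nhdsWithin hx hw))

omit [NormedSpace ℝ V] [NormedSpace ℝ Z] [NormedSpace ℝ F] in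
theorem ContinuousOn.exists_bound_closedBall [ProperSpace V] (hS : IsCompact S)
    (hu : ContinuousOn (fun p : V × Z => u p.1 p.2) (univ ×ˢ S)) (B : ℝ) :
    ∃ C : ℝ, 0 < C ∧ ∀ θ, ‖θ‖ ≤ B → ∀ z ∈ S, ‖u θ z‖ ≤ C := by
  obtain ⟨C, hC⟩ := ((isCompact_closedBall (0 : V) B).prod hS).exists_bound_of_continuousOn
    (hu.mono (prod_mono_left (subset_univ _)))
  refine ⟨max C 1, by positivity, fun θ hθ z hz => ?_⟩
  exact (hC (θ, z) ⟨by simpa using hθ, hz⟩).trans (le_max_left _ _)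

theorem ContDiffOn.exists_lipschitz_partial [ProperSpace V] (hS : IsCompact S)
    (hu : ContDiffOn ℝ 1 (fun p : V × Z => u p.1 p.2) (univ ×ˢ S)) (B : ℝ) :
    ∃ C : ℝ, 0 < C ∧ ∀ z ∈ S, ∀ θ θ', ‖θ‖ ≤ B → ‖θ'‖ ≤ B →
      ‖u θ z - u θ' z‖ ≤ C * ‖θ - θ'‖ := by
  obtain ⟨C, hC0, hC⟩ := ContinuousOn.exists_bound_closedBall
    (u := fun θ z => fderiv ℝ (fun θ' => u θ' z) θ) hS hu.continuousOn_fderiv_partial B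
  refine ⟨C, hC0, fun z hz θ θ' hθ hθ' => ?_⟩
  refine (convex_closedBall (0 : V) B).norm_image_sub_le_of_norm_hasFDerivWithin_le
    (f := fun θ => u θ z) (fun x _ => (hu.hasFDerivAt_partial hz).hasFDerivWithinAt)
    (fun x hx => hC x (by simpa using hx) z hz) (by simpa using hθ') (by simpa using hθ)

/-- Second-order Taylor estimate for a `C²` map, uniform on bounded sets. -/
theorem ContDiff.exists_norm_sub_fderiv_le [ProperSpace V] {v : V → F} (hv : ContDiff ℝ 2 v)
    (x₀ : V) (B : ℝ) : ∃ C : ℝ, 0 < C ∧ ∀ x, ‖x‖ ≤ B →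
      ‖v x - v x₀ - fderiv ℝ v x₀ (x - x₀)‖ ≤ C * ‖x - x₀‖ ^ 2 := by
  have h1 : ContDiff ℝ 1 (fderiv ℝ v) := hv.fderiv_right (by norm_num)
  -- The parameter is a dummy point. The radius covers every ball about x₀ of radius ‖x − x₀‖ with
  -- ‖x‖ ≤ B.
  obtain ⟨C, hC0, hC⟩ := ContDiffOn.exists_lipschitz_partial (S := ({0} : Set ℝ))
    (u := fun x (_ : ℝ) => fderiv ℝ v x) isCompact_singleton
    (h1.comp contDiff_fst).contDiffOn (‖x₀‖ + (B + ‖x₀‖))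
  refine ⟨C, hC0, fun x hx => ?_⟩
  have hxx : ‖x - x₀‖ ≤ B + ‖x₀‖ := (norm_sub_le _ _).trans (by gcongr)
  have h2 := (convex_closedBall x₀ ‖x - x₀‖).norm_image_sub_le_of_norm_fderiv_le' (𝕜 := ℝ)
    (f := v) (φ := fderiv ℝ v x₀) (C := C * ‖x - x₀‖) (x := x₀) (y := x)
    (fun y _ => hv.differentiable two_ne_zero y) (fun y hy => ?_) (by simp)
    (by simp [dist_eq_norm])
  · simpa only [pow_two, mul_assoc] using h2
  · rw [mem_closedBall_iff_norm] at hy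
    have hy' : ‖y‖ ≤ ‖x₀‖ + (B + ‖x₀‖) := by
      calc ‖y‖ = ‖x₀ + (y - x₀)‖ := by rw [add_sub_cancel]
        _ ≤ ‖x₀‖ + ‖y - x₀‖ := norm_add_le _ _
        _ ≤ _ := by linarith
    refine (hC 0 rfl y x₀ hy' ?_).trans (by gcongr)
    have := (norm_nonneg _).trans hxx
    linarith

omit [NormedSpace ℝ Z] in
/-- Differentiation under the integral sign for a measure carried by a compact set. -/
theorem hasFDerivAt_integral_of_continuousOn [ProperSpace V] [SecondCountableTopology Z]
    [MeasurableSpace Z] [BorelSpace Z] {μ : Measure Z} [IsFiniteMeasure μ] (hS : IsCompact S)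
    (hμ : ∀ᵐ z ∂μ, z ∈ S) {u' : V → Z → V →L[ℝ] F}
    (hc : ∀ θ, ContinuousOn (u θ) S)
    (hd : ∀ θ, ∀ z ∈ S, HasFDerivAt (fun θ' => u θ' z) (u' θ z) θ)
    (hc' : ContinuousOn (fun p : V × Z => u' p.1 p.2) (univ ×ˢ S)) (θ : V) :
    HasFDerivAt (fun θ' => ∫ z, u θ' z ∂μ) (∫ z, u' θ z ∂μ) θ := by
  have hres : μ.restrict S = μ := Measure.restrict_eq_self_of_ae_mem hμ
  have hmeas : ∀ θ, AEStronglyMeasurable (u θ) μ :=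
    fun θ => hres ▸ (hc θ).aestronglyMeasurable hS.measurableSet
  have hcθ : ContinuousOn (u' θ) S :=
    hc'.comp (f := fun z => (θ, z)) (by fun_prop) fun z hz => ⟨mem_univ _, hz⟩
  obtain ⟨C, -, hC⟩ := ContinuousOn.exists_bound_closedBall hS hc' (‖θ‖ + 1)
  refine hasFDerivAt_integral_of_dominated_of_fderiv_le (bound := fun _ => C)
    (Metric.ball_mem_nhds θ one_pos) (Eventually.of_forall hmeas) ?_
    (hres ▸ hcθ.aestronglyMeasurable hS.measurableSet) ?_
    (integrable_const _) ?_
  · have := (hc θ).integrableOn_compact (μ := μ) hS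
    rwa [IntegrableOn, hres] at this
  · filter_upwards [hμ] with z hz x hx
    refine hC x ?_ z hz
    rw [mem_ball_iff_norm] at hx
    calc ‖x‖ = ‖θ + (x - θ)‖ := by rw [add_sub_cancel]
      _ ≤ ‖θ‖ + ‖x - θ‖ := norm_add_le _ _
      _ ≤ _ := by linarith
  · filter_upwards [hμ] with z hz x _ using hd x z hz

end ParameterCalculus

/-! ### The clock and its invariant measure -/

namespace QSAModel

variable {d m K : ℕ} (M : QSAModel d m K)

theorem continuous_param : Continuous M.param := by
  refine continuous_pi fun i => continuous_const.mul ?_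
  exact continuous_subtype_val.comp ((continuous_apply i).comp continuous_subtype_val)

theorem isCompact_Omega : IsCompact M.Omega := by
  have := M.compactSpace_H
  exact isCompact_range M.continuous_param

theorem exp_eq_circleExp (i : Fin K) (t : ℝ) :
    Complex.exp (2 * Real.pi * Complex.I * (M.omega i * t)) =
      (Circle.exp (2 * Real.pi * (M.omega i * t)) : ℂ) := by
  rw [Circle.coe_exp]
  congr 1
  push_cast
  ring

theorem clock_param (t : ℝ) (h : M.H) :
    M.clock t (M.param h) = M.param (⟨_, M.rotation_mem_H t⟩ * h) := by
  ext i
  simp only [clock, param, exp_eq_circleExp, Subgroup.coe_mul, Pi.mul_apply, Circle.coe_mul]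
  ring

theorem clock_mem_Omega (t : ℝ) {z : Fin K → ℂ} (hz : z ∈ M.Omega) : M.clock t z ∈ M.Omega := by
  obtain ⟨h, rfl⟩ := hz
  exact ⟨_, (M.clock_param t h).symm⟩

theorem clock_zero (z : Fin K → ℂ) : M.clock 0 z = z := by
  ext i
  simp [clock]

theorem clock_clock (s t : ℝ) (z : Fin K → ℂ) : M.clock s (M.clock t z) = M.clock (s + t) z := by
  ext i
  simp only [clock]
  rw [← mul_assoc, ← Complex.exp_add]
  congr 2
  push_cast
  ring

theorem continuous_clock : Continuous fun p : ℝ × (Fin K → ℂ) => M.clock p.1 p.2 := by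
  unfold clock
  fun_prop

theorem exists_hasDerivAt_clock (z : Fin K → ℂ) (t : ℝ) :
    ∃ z', HasDerivAt (fun t => M.clock t z) z' t := by
  refine ⟨deriv (fun t => M.clock t z) t, DifferentiableAt.hasDerivAt ?_⟩
  rw [differentiableAt_pi]
  intro i
  have : DifferentiableAt ℝ (fun t : ℝ => (t : ℂ)) t := Complex.ofRealCLM.differentiableAt
  unfold clock
  fun_prop

theorem continuousOn_G : ContinuousOn M.G M.Omega := by
  refine M.continuous_G₀.comp_continuousOn (continuousOn_pi.2 fun i => ?_)
  refine Complex.continuous_re.comp_continuousOn (ContinuousOn.div_const ?_ _)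
  refine ContinuousOn.add (by fun_prop) (ContinuousOn.inv₀ (by fun_prop) ?_)
  rintro _ ⟨h, rfl⟩
  simp [param]

/-- By `clock_param` the clock acts on Ω as translation by an element of `H`, and Haar measure is
translation invariant. -/
theorem unif_spec : IsProbabilityMeasure M.unif ∧ (∀ᵐ z ∂M.unif, z ∈ M.Omega) ∧
    ∀ t, M.unif.map (M.clock t) = M.unif := by
  have := M.compactSpace_H
  let : MeasurableSpace M.H := borel M.H
  have : BorelSpace M.H := ⟨rfl⟩
  have hunif : M.unif =
    (Measure.haarMeasure (⊤ : TopologicalSpace.PositiveCompacts M.H)).map M.param := rfl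
  have hp : Measurable M.param := M.continuous_param.measurable
  rw [hunif]
  refine ⟨?_, ?_, fun t => ?_⟩
  · have : IsProbabilityMeasure
        (Measure.haarMeasure (⊤ : TopologicalSpace.PositiveCompacts M.H)) :=
      ⟨by simpa using Measure.haarMeasure_self (K₀ := (⊤ : TopologicalSpace.PositiveCompacts M.H))⟩
    exact Measure.isProbabilityMeasure_map hp.aemeasurable
  · refine (ae_map_iff (p := fun z => z ∈ M.Omega) hp.aemeasurable
      M.isCompact_Omega.measurableSet).2 ?_
    exact Eventually.of_forall fun h => ⟨h, rfl⟩
  · have hclock : Measurable (M.clock t) :=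
      (M.continuous_clock.comp (Continuous.prodMk_right t)).measurable
    rw [Measure.map_map hclock hp]
    have : M.clock t ∘ M.param = M.param ∘ fun h => ⟨_, M.rotation_mem_H t⟩ * h :=
      funext fun h => M.clock_param t h
    rw [this, ← Measure.map_map hp (measurable_const_mul _), map_mul_left_eq_self]

instance : IsProbabilityMeasure M.unif := M.unif_spec.1

theorem ae_mem_Omega : ∀ᵐ z ∂M.unif, z ∈ M.Omega := M.unif_spec.2.1

theorem map_clock_unif (t : ℝ) : M.unif.map (M.clock t) = M.unif := M.unif_spec.2.2 t

theorem integrable_of_continuousOn {F : Type*} [NormedAddCommGroup F] {φ : (Fin K → ℂ) → F}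
    (hφ : ContinuousOn φ M.Omega) : Integrable φ M.unif := by
  have := hφ.integrableOn_compact (μ := M.unif) M.isCompact_Omega
  rwa [IntegrableOn, Measure.restrict_eq_self_of_ae_mem M.ae_mem_Omega] at this

theorem integral_clock {F : Type*} [NormedAddCommGroup F] [NormedSpace ℝ F]
    {φ : (Fin K → ℂ) → F} (hφ : ContinuousOn φ M.Omega) (t : ℝ) :
    ∫ z, φ (M.clock t z) ∂M.unif = ∫ z, φ z ∂M.unif := by
  have hclock : Measurable (M.clock t) :=
    (M.continuous_clock.comp (Continuous.prodMk_right t)).measurable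
  have h := integral_map (μ := M.unif) (φ := M.clock t) (f := φ) hclock.aemeasurable
    (by rw [M.map_clock_unif]; exact (M.integrable_of_continuousOn hφ).aestronglyMeasurable)
  rw [← h, M.map_clock_unif]

end QSAModel

/-! ### Poisson's equation: derivative along trajectories and antisymmetry -/

namespace QSAModel

variable {d m K : ℕ} {M : QSAModel d m K}

local notation "E" => EuclideanSpace ℝ (Fin d)

namespace IsSmoothPoissonSolution

variable {g ghat : EuclideanSpace ℝ (Fin d) → (Fin K → ℂ) → EuclideanSpace ℝ (Fin d)}

theorem continuousOn (h : M.IsSmoothPoissonSolution g ghat) (θ : E) :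
    ContinuousOn (ghat θ) M.Omega :=
  h.contDiffOn.continuousOn.comp (f := fun z => (θ, z)) (by fun_prop) fun _ hz => ⟨mem_univ _, hz⟩

theorem hasDerivAt_clock (h : M.IsSmoothPoissonSolution g ghat) {θ : E}
    (hg : ContinuousOn (g θ) M.Omega) {z : Fin K → ℂ} (hz : z ∈ M.Omega) (t : ℝ) :
    HasDerivAt (fun t => ghat θ (M.clock t z)) (-(g θ (M.clock t z) - M.mean g θ)) t := by
  -- Poisson's equation is given only for T ≥ 0 and would yield a one-sided derivative at 0. A
  -- two-sided one is taken at T = 1 and shifted to t by starting the clock at time t − 1.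
  have hpos : ∀ z ∈ M.Omega, HasDerivAt (fun t => ghat θ (M.clock t z))
      (-(g θ (M.clock 1 z) - M.mean g θ)) 1 := by
    intro z hz
    have hk : Continuous fun s => g θ (M.clock s z) - M.mean g θ := by
      refine Continuous.sub ?_ continuous_const
      exact hg.comp_continuous (M.continuous_clock.comp (Continuous.prodMk_left z))
        fun s => M.clock_mem_Omega s hz
    have h1 : HasDerivAt (fun T => ghat θ z - ∫ s in (0 : ℝ)..T, (g θ (M.clock s z) - M.mean g θ))
        (-(g θ (M.clock 1 z) - M.mean g θ)) 1 :=
      (hk.integral_hasStrictDerivAt 0 1).hasDerivAt.const_sub _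
    refine h1.congr_of_eventuallyEq ?_
    filter_upwards [Ioi_mem_nhds (show (0 : ℝ) < 1 from one_pos)] with T hT
    rw [h.poisson θ z hz T (le_of_lt hT), add_sub_cancel_right]
  have h2 := hpos _ (M.clock_mem_Omega (t - 1) hz)
  rw [M.clock_clock, add_sub_cancel] at h2
  have h3 : HasDerivAt (fun s => ghat θ (M.clock (s - (t - 1)) (M.clock (t - 1) z)))
      (-(g θ (M.clock t z) - M.mean g θ)) t := by
    exact HasDerivAt.comp_sub_const (f := fun s => ghat θ (M.clock s (M.clock (t - 1) z))) t (t - 1)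
      (by rwa [sub_sub_cancel])
  simpa only [M.clock_clock, sub_add_cancel] using h3

/-- The derivative of a solution of Poisson's equation along a curve driven by the clock. -/
theorem hasDerivWithinAt_comp (h : M.IsSmoothPoissonSolution g ghat)
    (hg : ∀ θ, ContinuousOn (g θ) M.Omega) {z : Fin K → ℂ} (hz : z ∈ M.Omega) {Θ : ℝ → E}
    {Θ' : E} {t : ℝ} (ht : 0 ≤ t) (hΘ : HasDerivWithinAt Θ Θ' (Ici 0) t) :
    HasDerivWithinAt (fun t => ghat (Θ t) (M.clock t z))
      (fderiv ℝ (fun θ => ghat θ (M.clock t z)) (Θ t) Θ' -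
        (g (Θ t) (M.clock t z) - M.mean g (Θ t))) (Ici 0) t := by
  have hmem := M.clock_mem_Omega t hz
  obtain ⟨z', hz'⟩ := M.exists_hasDerivAt_clock z t
  have h1 := (h.contDiffOn.differentiableOn one_ne_zero (Θ t, M.clock t z)
    ⟨mem_univ _, hmem⟩).hasFDerivWithinAt
  -- D need not be unique, but only two of its values matter: on (0, z') Poisson's equation fixes
  -- it, and on (Θ', 0) it is the partial derivative in θ. Linearity adds the two.
  set D := fderivWithin ℝ (fun p : E × (Fin K → ℂ) => ghat p.1 p.2) (univ ×ˢ M.Omega)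
    (Θ t, M.clock t z)
  have h2 : HasDerivWithinAt (fun t => ghat (Θ t) (M.clock t z)) (D (Θ', z')) (Ici 0) t :=
    HasFDerivWithinAt.comp_hasDerivWithinAt (f := fun t => (Θ t, M.clock t z)) t h1
      (hΘ.prodMk hz'.hasDerivWithinAt) fun s _ => ⟨mem_univ _, M.clock_mem_Omega s hz⟩
  have h3 : HasDerivWithinAt (fun s => ghat (Θ t) (M.clock s z)) (D (0, z')) (Ici 0) t :=
    HasFDerivWithinAt.comp_hasDerivWithinAt (f := fun s => (Θ t, M.clock s z)) t h1
      ((hasDerivWithinAt_const t (Ici 0) (Θ t)).prodMk hz'.hasDerivWithinAt)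
      fun s _ => ⟨mem_univ _, M.clock_mem_Omega s hz⟩
  have h4 : D (0, z') = -(g (Θ t) (M.clock t z) - M.mean g (Θ t)) :=
    (uniqueDiffOn_Ici (0 : ℝ) t ht).eq_deriv _ h3
      (h.hasDerivAt_clock (hg _) hz t).hasDerivWithinAt
  have h5 : HasFDerivAt (fun θ => ghat θ (M.clock t z))
      (D.comp (ContinuousLinearMap.inl ℝ E (Fin K → ℂ))) (Θ t) := by
    have h6 : HasFDerivWithinAt (fun θ : E => (θ, M.clock t z))
        (ContinuousLinearMap.inl ℝ E (Fin K → ℂ)) univ (Θ t) :=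
      (hasFDerivAt_prodMk_left _ _).hasFDerivWithinAt
    exact (HasFDerivWithinAt.comp (f := fun θ : E => (θ, M.clock t z)) (Θ t) h1 h6
      fun _ _ => ⟨mem_univ _, hmem⟩).hasFDerivAt_of_univ
  rw [h5.fderiv, sub_eq_add_neg, ← h4]
  refine h2.congr_deriv ?_
  rw [ContinuousLinearMap.comp_apply, ContinuousLinearMap.inl_apply, ← map_add, Prod.mk_add_mk,
    add_zero, zero_add]

/-- Antisymmetry of the solution operator of Poisson's equation. -/
theorem integral_smul_eq_neg (h : M.IsSmoothPoissonSolution g ghat)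
    (hg : ∀ θ, ContinuousOn (g θ) M.Omega) (ℓ : E →L[ℝ] ℝ) (θ₁ θ₂ : E) :
    ∫ z, ℓ (g θ₂ z) • ghat θ₁ z ∂M.unif = -∫ z, ℓ (ghat θ₂ z) • g θ₁ z ∂M.unif := by
  -- r along the clock is the derivative of ℓ(ĝ(θ₂, Φ)) ĝ(θ₁, Φ), whose mean is constant in time by
  -- invariance; hence r has mean zero. The terms with ḡ drop out because ĝ has mean zero.
  let r : (Fin K → ℂ) → E := fun z =>
    ℓ (ghat θ₂ z) • (-(g θ₁ z - M.mean g θ₁)) + ℓ (-(g θ₂ z - M.mean g θ₂)) • ghat θ₁ z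
  let toSpan : E ≃L[ℝ] (ℝ →L[ℝ] E) := ContinuousLinearMap.toSpanSingletonCLE
  have hc1 := h.continuousOn θ₁
  have hc2 := h.continuousOn θ₂
  have hcℓ : ∀ {φ : (Fin K → ℂ) → E}, ContinuousOn φ M.Omega →
      ContinuousOn (fun z => ℓ (φ z)) M.Omega := fun hφ => ℓ.continuous.comp_continuousOn hφ
  have hr : ContinuousOn r M.Omega :=
    ((hcℓ hc2).smul ((hg θ₁).sub continuousOn_const).neg).add
      ((hcℓ ((hg θ₂).sub continuousOn_const).neg).smul hc1)
  have hq : ContinuousOn (fun z => ℓ (ghat θ₂ z) • ghat θ₁ z) M.Omega := (hcℓ hc2).smul hc1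
  have hclock : ∀ t, ContinuousOn (M.clock t) M.Omega := fun t =>
    (M.continuous_clock.comp (Continuous.prodMk_right t)).continuousOn
  have hD := hasFDerivAt_integral_of_continuousOn (V := ℝ) (S := M.Omega) (μ := M.unif)
    (u := fun t z => ℓ (ghat θ₂ (M.clock t z)) • ghat θ₁ (M.clock t z))
    (u' := fun t z => ContinuousLinearMap.toSpanSingleton ℝ (r (M.clock t z)))
    M.isCompact_Omega M.ae_mem_Omega
    (fun t => hq.comp (hclock t) fun z hz => M.clock_mem_Omega t hz)
    (fun t z hz => by
      have h1 := h.hasDerivAt_clock (hg θ₁) hz t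
      have h2 := ℓ.hasFDerivAt.comp_hasDerivAt t (h.hasDerivAt_clock (hg θ₂) hz t)
      exact (h2.smul h1).hasFDerivAt)
    (by
      refine toSpan.continuous.comp_continuousOn
        (hr.comp M.continuous_clock.continuousOn fun p hp => M.clock_mem_Omega p.1 hp.2)) 0
  have hconst : (fun t => ∫ z, ℓ (ghat θ₂ (M.clock t z)) • ghat θ₁ (M.clock t z) ∂M.unif) =
      fun _ => ∫ z, ℓ (ghat θ₂ z) • ghat θ₁ z ∂M.unif :=
    funext fun t => M.integral_clock hq t
  rw [hconst] at hD
  have h0 := hD.unique (hasFDerivAt_const _ _)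
  simp only [M.clock_zero] at h0
  have hint : ∀ {φ : (Fin K → ℂ) → E}, ContinuousOn φ M.Omega → Integrable φ M.unif :=
    fun hφ => M.integrable_of_continuousOn hφ
  have hr0 : ∫ z, r z ∂M.unif = 0 := by
    have h1 := ContinuousLinearMap.integral_comp_comm
      toSpan.toContinuousLinearMap (hint hr)
    have h2 : toSpan (∫ z, r z ∂M.unif) = 0 :=
      h1.symm.trans h0
    simpa using h2
  have hm1 : ∫ z, ℓ (ghat θ₂ z) • M.mean g θ₁ ∂M.unif = 0 := by
    rw [integral_smul_const, ContinuousLinearMap.integral_comp_comm ℓ (hint hc2)]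
    have : ∫ z, ghat θ₂ z ∂M.unif = 0 := h.mean_zero θ₂
    rw [this, map_zero, zero_smul]
  have hm2 : ∫ z, ℓ (M.mean g θ₂) • ghat θ₁ z ∂M.unif = 0 := by
    rw [integral_smul]
    have : ∫ z, ghat θ₁ z ∂M.unif = 0 := h.mean_zero θ₁
    rw [this, smul_zero]
  have hexp : ∀ z, r z = (ℓ (ghat θ₂ z) • M.mean g θ₁ - ℓ (ghat θ₂ z) • g θ₁ z) +
      (ℓ (M.mean g θ₂) • ghat θ₁ z - ℓ (g θ₂ z) • ghat θ₁ z) := by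
    intro z
    simp only [r, neg_sub, map_sub, smul_sub, sub_smul]
  have i1 : Integrable (fun z => ℓ (ghat θ₂ z) • M.mean g θ₁) M.unif := hint ((hcℓ hc2).smul (continuousOn_const (c := M.mean g θ₁)))
  have i2 : Integrable (fun z => ℓ (ghat θ₂ z) • g θ₁ z) M.unif := hint ((hcℓ hc2).smul (hg θ₁))
  have i3 : Integrable (fun z => ℓ (M.mean g θ₂) • ghat θ₁ z) M.unif :=
    hint ((continuousOn_const (c := ℓ (M.mean g θ₂))).smul hc1)
  have i4 : Integrable (fun z => ℓ (g θ₂ z) • ghat θ₁ z) M.unif := hint ((hcℓ (hg θ₂)).smul hc1)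
  have i12 : Integrable (fun z => ℓ (ghat θ₂ z) • M.mean g θ₁ - ℓ (ghat θ₂ z) • g θ₁ z) M.unif :=
    i1.sub i2
  have i34 : Integrable (fun z => ℓ (M.mean g θ₂) • ghat θ₁ z - ℓ (g θ₂ z) • ghat θ₁ z) M.unif :=
    i3.sub i4
  simp_rw [hexp] at hr0
  rw [integral_add i12 i34, integral_sub i1 i2, integral_sub i3 i4, hm1, hm2,
    zero_sub, zero_sub] at hr0
  rw [eq_neg_iff_add_eq_zero, ← neg_eq_zero, neg_add, add_comm]
  exact hr0

/-- The adjoint form of the bias vector: the derivative can be moved from the solution of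
Poisson's equation to its forcing function. -/
theorem integral_fderiv_apply_eq_neg (h : M.IsSmoothPoissonSolution g ghat)
    (hg : ContinuousOn (fun p : E × (Fin K → ℂ) => g p.1 p.2) (univ ×ˢ M.Omega))
    (hgd : ∀ θ, ∀ z ∈ M.Omega, DifferentiableAt ℝ (fun θ' => g θ' z) θ)
    (hg' : ContinuousOn (fun p : E × (Fin K → ℂ) => fderiv ℝ (fun θ' => g θ' p.2) p.1)
      (univ ×ˢ M.Omega)) (θ : E) :
    ∫ z, fderiv ℝ (fun θ' => ghat θ' z) θ (g θ z) ∂M.unif =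
      -∫ z, fderiv ℝ (fun θ' => g θ' z) θ (ghat θ z) ∂M.unif := by
  have hsec : ∀ {F : Type} [TopologicalSpace F] {φ : E × (Fin K → ℂ) → F} (θ : E),
      ContinuousOn φ (univ ×ˢ M.Omega) → ContinuousOn (fun z => φ (θ, z)) M.Omega :=
    fun θ hφ => hφ.comp (f := fun z => (θ, z)) (by fun_prop) fun _ hz => ⟨mem_univ _, hz⟩
  have hcg : ∀ θ, ContinuousOn (g θ) M.Omega := fun θ => hsec θ hg
  have hghat' := h.contDiffOn.continuousOn_fderiv_partial
  -- Antisymmetry is differentiated in θ₁ with θ₂ = θ frozen, so each side loses only one factor to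
  -- the derivative. Coordinate functionals and basis vectors then reassemble the contraction.
  have key : ∀ ℓ : E →L[ℝ] ℝ,
      ∫ z, ℓ (g θ z) • fderiv ℝ (fun θ' => ghat θ' z) θ ∂M.unif =
        -∫ z, ℓ (ghat θ z) • fderiv ℝ (fun θ' => g θ' z) θ ∂M.unif := by
    intro ℓ
    have hℓ1 : ContinuousOn (fun z => ℓ (g θ z)) M.Omega := ℓ.continuous.comp_continuousOn (hcg θ)
    have hℓ2 : ContinuousOn (fun z => ℓ (ghat θ z)) M.Omega :=
      ℓ.continuous.comp_continuousOn (h.continuousOn θ)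
    have hmaps : MapsTo Prod.snd ((univ : Set E) ×ˢ M.Omega) M.Omega := fun p hp => hp.2
    have d1 := hasFDerivAt_integral_of_continuousOn (V := E) (S := M.Omega) (μ := M.unif)
      (u := fun θ₁ z => ℓ (g θ z) • ghat θ₁ z)
      (u' := fun θ₁ z => ℓ (g θ z) • fderiv ℝ (fun θ' => ghat θ' z) θ₁)
      M.isCompact_Omega M.ae_mem_Omega (fun θ₁ => hℓ1.smul (h.continuousOn θ₁))
      (fun θ₁ z hz => (h.contDiffOn.hasFDerivAt_partial hz).fun_const_smul _)
      ((hℓ1.comp continuousOn_snd hmaps).smul hghat') θ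
    have d2 := hasFDerivAt_integral_of_continuousOn (V := E) (S := M.Omega) (μ := M.unif)
      (u := fun θ₁ z => ℓ (ghat θ z) • g θ₁ z)
      (u' := fun θ₁ z => ℓ (ghat θ z) • fderiv ℝ (fun θ' => g θ' z) θ₁)
      M.isCompact_Omega M.ae_mem_Omega (fun θ₁ => hℓ2.smul (hcg θ₁))
      (fun θ₁ z hz => (hgd θ₁ z hz).hasFDerivAt.fun_const_smul _)
      ((hℓ2.comp continuousOn_snd hmaps).smul hg') θ
    rw [funext fun θ₁ => h.integral_smul_eq_neg hcg ℓ θ₁ θ] at d1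
    exact d1.unique d2.neg
  have hsum : ∀ (D : E →L[ℝ] E) (x : E), D x = ∑ j, (EuclideanSpace.proj j x : ℝ) •
      D (EuclideanSpace.basisFun (Fin d) ℝ j) := by
    intro D x
    conv_lhs => rw [← (EuclideanSpace.basisFun (Fin d) ℝ).sum_repr x]
    rw [map_sum]
    refine Finset.sum_congr rfl fun j _ => ?_
    rw [map_smul]
    rfl
  have hexpand : ∀ (φ : (Fin K → ℂ) → E) (D : (Fin K → ℂ) → E →L[ℝ] E), ContinuousOn φ M.Omega →
      ContinuousOn D M.Omega → ∫ z, D z (φ z) ∂M.unif =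
        ∑ j, (∫ z, (EuclideanSpace.proj j (φ z) : ℝ) • D z ∂M.unif)
          (EuclideanSpace.basisFun (Fin d) ℝ j) := by
    intro φ D hφ hD
    have hi : ∀ j, ContinuousOn (fun z => (EuclideanSpace.proj j (φ z) : ℝ) • D z) M.Omega :=
      fun j => ((EuclideanSpace.proj j).continuous.comp_continuousOn hφ).smul hD
    simp_rw [hsum _ (φ _)]
    rw [integral_finsetSum]
    · refine Finset.sum_congr rfl fun j _ => ?_
      rw [ContinuousLinearMap.integral_apply (M.integrable_of_continuousOn (hi j))]
      rfl
    · exact fun j _ => M.integrable_of_continuousOn ((hi j).clm_apply continuousOn_const)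
  rw [hexpand _ _ (hcg θ) (hsec θ hghat'), hexpand _ _ (h.continuousOn θ) (hsec θ hg'),
    ← Finset.sum_neg_distrib]
  refine Finset.sum_congr rfl fun j _ => ?_
  rw [key (EuclideanSpace.proj j), neg_apply]

end IsSmoothPoissonSolution

end QSAModel

/-! ### Regularity of the bias vector and the O(α) bound -/

namespace QSAModel

variable {d m K : ℕ} {M : QSAModel d m K}

local notation "E" => EuclideanSpace ℝ (Fin d)

theorem SmoothFields.contDiff_fderiv (h : M.SmoothFields) :
    ContDiff ℝ 1 fun p : E × EuclideanSpace ℝ (Fin m) =>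
      fderiv ℝ (fun θ => M.f θ p.2) p.1 := by
  have heq : (fun p : E × EuclideanSpace ℝ (Fin m) => fderiv ℝ (fun θ => M.f θ p.2) p.1) =
      fun p => (fderiv ℝ (fun p : E × EuclideanSpace ℝ (Fin m) => M.f p.1 p.2) p).comp
        (ContinuousLinearMap.inl ℝ _ _) := by
    funext p
    have h1 := ((h.1.differentiable two_ne_zero) p).hasFDerivAt
    exact (HasFDerivAt.comp (f := fun θ : E => (θ, p.2)) p.1 h1
      (hasFDerivAt_prodMk_left p.1 p.2)).fderiv
  rw [heq]
  exact (h.1.fderiv_right (m := 1) (by norm_num)).clm_comp contDiff_const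

theorem continuousOn_prodMk_G :
    ContinuousOn (fun p : E × (Fin K → ℂ) => (p.1, M.G p.2)) (univ ×ˢ M.Omega) :=
  continuousOn_fst.prodMk (M.continuousOn_G.comp continuousOn_snd fun _ hp => hp.2)

theorem SmoothFields.continuousOn_fG (h : M.SmoothFields) :
    ContinuousOn (fun p : E × (Fin K → ℂ) => M.fG p.1 p.2) (univ ×ˢ M.Omega) :=
  h.1.continuous.comp_continuousOn continuousOn_prodMk_G

theorem SmoothFields.continuousOn_fderiv_fG (h : M.SmoothFields) :
    ContinuousOn (fun p : E × (Fin K → ℂ) => fderiv ℝ (fun θ => M.fG θ p.2) p.1)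
      (univ ×ˢ M.Omega) :=
  h.contDiff_fderiv.continuous.comp_continuousOn continuousOn_prodMk_G

theorem SmoothFields.differentiableAt_fG (h : M.SmoothFields) (θ : E) (z : Fin K → ℂ) :
    DifferentiableAt ℝ (fun θ => M.fG θ z) θ :=
  ((h.1.differentiable two_ne_zero).comp
    (differentiable_id.prodMk (differentiable_const (M.G z)))) θ

theorem ContinuousOn.section {F : Type*} [TopologicalSpace F] {φ : E → (Fin K → ℂ) → F}
    (hφ : ContinuousOn (fun p : E × (Fin K → ℂ) => φ p.1 p.2) (univ ×ˢ M.Omega)) (θ : E) :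
    ContinuousOn (φ θ) M.Omega :=
  hφ.comp (f := fun z => (θ, z)) (by fun_prop) fun _ hz => ⟨mem_univ _, hz⟩

variable {g ghat fhat : EuclideanSpace ℝ (Fin d) → (Fin K → ℂ) → EuclideanSpace ℝ (Fin d)}

/-- The derivative of a Poisson solution in the direction of the vector field. -/
theorem IsSmoothPoissonSolution.continuousOn_fderiv_fG (hP : M.IsSmoothPoissonSolution g ghat)
    (h : M.SmoothFields) :
    ContinuousOn (fun p : E × (Fin K → ℂ) =>
      fderiv ℝ (fun θ => ghat θ p.2) p.1 (M.fG p.1 p.2)) (univ ×ˢ M.Omega) :=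
  hP.contDiffOn.continuousOn_fderiv_partial.clm_apply h.continuousOn_fG

theorem IsSmoothPoissonSolution.continuousOn_Upsilon (hP : M.IsSmoothPoissonSolution M.fG fhat)
    (h : M.SmoothFields) :
    ContinuousOn (fun p : E × (Fin K → ℂ) => M.Upsilon fhat p.1 p.2) (univ ×ˢ M.Omega) :=
  (hP.continuousOn_fderiv_fG h).neg

/-- This form differentiates f, which is C², instead of f̂, which is only C¹; it is the source of
the Lipschitz bound for Ῡ. -/
theorem IsSmoothPoissonSolution.UpsilonBar_eq (hP : M.IsSmoothPoissonSolution M.fG fhat)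
    (h : M.SmoothFields) (θ : E) :
    M.UpsilonBar fhat θ = ∫ z, fderiv ℝ (fun θ' => M.fG θ' z) θ (fhat θ z) ∂M.unif := by
  have h1 := hP.integral_fderiv_apply_eq_neg h.continuousOn_fG
    (fun θ z _ => h.differentiableAt_fG θ z) h.continuousOn_fderiv_fG θ
  have h2 : M.UpsilonBar fhat θ =
      ∫ z, -(fderiv ℝ (fun θ' => fhat θ' z) θ (M.fG θ z)) ∂M.unif := rfl
  rw [h2, integral_neg, h1, neg_neg]

/-- The bias vector is Lipschitz on bounded sets. -/
theorem IsSmoothPoissonSolution.exists_lipschitz_UpsilonBar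
    (hP : M.IsSmoothPoissonSolution M.fG fhat) (h : M.SmoothFields) (B : ℝ) :
    ∃ C : ℝ, 0 < C ∧ ∀ θ θ', ‖θ‖ ≤ B → ‖θ'‖ ≤ B →
      ‖M.UpsilonBar fhat θ - M.UpsilonBar fhat θ'‖ ≤ C * ‖θ - θ'‖ := by
  obtain ⟨L₁, hL₁, h₁⟩ := ContDiffOn.exists_lipschitz_partial (S := M.G '' M.Omega)
    (u := fun θ ξ => fderiv ℝ (fun θ => M.f θ ξ) θ)
    (M.isCompact_Omega.image_of_continuousOn M.continuousOn_G) h.contDiff_fderiv.contDiffOn B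
  obtain ⟨L₂, hL₂, h₂⟩ := hP.contDiffOn.exists_lipschitz_partial M.isCompact_Omega B
  obtain ⟨C₁, hC₁, hb₁⟩ := ContinuousOn.exists_bound_closedBall
    (u := fun θ z => fderiv ℝ (fun θ => M.fG θ z) θ) M.isCompact_Omega h.continuousOn_fderiv_fG B
  obtain ⟨C₂, hC₂, hb₂⟩ := ContinuousOn.exists_bound_closedBall M.isCompact_Omega
    hP.contDiffOn.continuousOn B
  refine ⟨L₁ * C₂ + C₁ * L₂, by positivity, fun θ θ' hθ hθ' => ?_⟩
  have hint : ∀ θ, Integrable (fun z => fderiv ℝ (fun θ' => M.fG θ' z) θ (fhat θ z)) M.unif :=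
    fun θ => M.integrable_of_continuousOn
      (ContinuousOn.section (φ := fun θ z => fderiv ℝ (fun θ' => M.fG θ' z) θ (fhat θ z))
        (h.continuousOn_fderiv_fG.clm_apply hP.contDiffOn.continuousOn) θ)
  rw [hP.UpsilonBar_eq h, hP.UpsilonBar_eq h, ← integral_sub (hint θ) (hint θ')]
  have hb : ∀ᵐ z ∂M.unif, ‖fderiv ℝ (fun θ' => M.fG θ' z) θ (fhat θ z) -
      fderiv ℝ (fun θ' => M.fG θ' z) θ' (fhat θ' z)‖ ≤ (L₁ * C₂ + C₁ * L₂) * ‖θ - θ'‖ := by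
    filter_upwards [M.ae_mem_Omega] with z hz
    have e : fderiv ℝ (fun θ' => M.fG θ' z) θ (fhat θ z) -
        fderiv ℝ (fun θ' => M.fG θ' z) θ' (fhat θ' z) =
        (fderiv ℝ (fun θ' => M.fG θ' z) θ - fderiv ℝ (fun θ' => M.fG θ' z) θ') (fhat θ z) +
          fderiv ℝ (fun θ' => M.fG θ' z) θ' (fhat θ z - fhat θ' z) := by
      rw [sub_apply, map_sub]
      abel
    rw [e]
    refine (norm_add_le _ _).trans ?_
    have b1 := (ContinuousLinearMap.le_opNorm (fderiv ℝ (fun θ' => M.fG θ' z) θ -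
      fderiv ℝ (fun θ' => M.fG θ' z) θ') (fhat θ z)).trans
      (mul_le_mul (h₁ _ (mem_image_of_mem _ hz) θ θ' hθ hθ') (hb₂ θ hθ z hz) (norm_nonneg _)
        (by positivity))
    have b2 := (ContinuousLinearMap.le_opNorm (fderiv ℝ (fun θ' => M.fG θ' z) θ')
      (fhat θ z - fhat θ' z)).trans
      (mul_le_mul (hb₁ θ' hθ' z hz) (h₂ z hz θ θ' hθ hθ') (norm_nonneg _) (by positivity))
    linarith
  have := norm_integral_le_of_norm_le_const hb
  simpa using this

/-- The derivative of a Poisson solution along a trajectory. -/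
theorem IsSmoothPoissonSolution.hasDerivWithinAt_solution
    (hP : M.IsSmoothPoissonSolution g ghat) (hg : ∀ θ, ContinuousOn (g θ) M.Omega) {α : ℝ}
    {z : Fin K → ℂ} (hz : z ∈ M.Omega) {Θ : ℝ → E} (hΘ : M.IsSolution α z Θ) {t : ℝ}
    (ht : 0 ≤ t) :
    HasDerivWithinAt (fun t => ghat (Θ t) (M.clock t z))
      (α • fderiv ℝ (fun θ => ghat θ (M.clock t z)) (Θ t) (M.fG (Θ t) (M.clock t z)) -
        (g (Θ t) (M.clock t z) - M.mean g (Θ t))) (Ici 0) t := by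
  have := hP.hasDerivWithinAt_comp hg hz ht (hΘ t ht)
  rwa [map_smul] at this

theorem exists_lipschitzWith_fbar (h : M.LipschitzFields) : ∃ L : NNReal, LipschitzWith L M.fbar := by
  obtain ⟨L, hL, -⟩ := h
  refine ⟨L.toNNReal, LipschitzWith.of_dist_le_mul fun x y => ?_⟩
  rw [dist_eq_norm, dist_eq_norm]
  exact (hL y x).trans (by gcongr; exact Real.le_coe_toNNReal L)

/-- The estimates stay ultimately within `O(α)` of the equilibrium. -/
theorem StableFamily.exists_eventually_norm_sub_le {α₀ : ℝ} {θs : E} (hS : M.StableFamily α₀ θs)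
    (hLip : M.LipschitzFields) (h : M.SmoothFields) (hP : M.IsSmoothPoissonSolution M.fG fhat) :
    ∃ C : ℝ, 0 < C ∧ ∀ α : ℝ, 0 < α → α ≤ α₀ → ∀ z ∈ M.Omega, ∀ Θ, M.IsSolution α z Θ →
      ∀ᶠ t in atTop, ‖Θ t - θs‖ ≤ C * α := by
  obtain ⟨B, hB⟩ := hS.ultimatelyBounded
  obtain ⟨L, hL⟩ := exists_lipschitzWith_fbar hLip
  obtain ⟨C₁, hC₁, hb₁⟩ := ContinuousOn.exists_bound_closedBall M.isCompact_Omega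
    hP.contDiffOn.continuousOn B
  obtain ⟨C₂, hC₂, hb₂⟩ := ContinuousOn.exists_bound_closedBall M.isCompact_Omega
    (hP.continuousOn_Upsilon h) B
  obtain ⟨ε, C, hε, hC, hmain⟩ := hS.hurwitz.exists_eventually_norm_sub_le_of_attractive hL
    (h.2.of_le one_le_two) ((hS.gas.unique_equilibrium θs).2 rfl) hS.gas.attractive
    (isCompact_closedBall (0 : E) (B + α₀ * C₁))
  -- L·C₁ pays for evaluating f̄ at Θ + α f̂ instead of Θ, and C₂ for the term αΥ.
  set c := L * C₁ + C₂
  have hc : 0 < c := by positivity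
  have hα₀ := hS.pos
  refine ⟨max (C * c + C₁) ((B + ‖θs‖) * c / ε), lt_max_of_lt_left (by positivity),
    fun α hα hαα z hz Θ hΘ => ?_⟩
  obtain ⟨t₀, ht₀⟩ := hB α hα hαα z hz Θ hΘ
  set t₁ := max t₀ 0
  have ht₁ : 0 ≤ t₁ := le_max_right _ _
  have hbd : ∀ t, t₁ ≤ t → ‖Θ t‖ ≤ B := fun t ht =>
    ht₀ t ((le_max_left _ _).trans ht) ((le_max_right _ _).trans ht)
  rcases le_or_gt (c * α) ε with hcα | hcα
  · have hev := hmain α (c * α) t₁ (fun t => Θ t + α • fhat (Θ t) (M.clock t z))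
      (fun t => M.fbar (Θ t) - M.fbar (Θ t + α • fhat (Θ t) (M.clock t z)) -
        α • M.Upsilon fhat (Θ t) (M.clock t z)) hα (by positivity) hcα ?_ ?_ ?_
    · filter_upwards [hev, eventually_ge_atTop t₁] with t h1 ht
      have h2 : ‖α • fhat (Θ t) (M.clock t z)‖ ≤ α * C₁ := by
        rw [norm_smul, Real.norm_of_nonneg hα.le]
        gcongr
        exact hb₁ _ (hbd t ht) _ (M.clock_mem_Omega t hz)
      have h3 : Θ t - θs = (Θ t + α • fhat (Θ t) (M.clock t z) - θs) -
          α • fhat (Θ t) (M.clock t z) := by abel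
      calc ‖Θ t - θs‖ ≤ C * (c * α) + α * C₁ := by
            rw [h3]
            exact (norm_sub_le _ _).trans (add_le_add h1 h2)
        _ = (C * c + C₁) * α := by ring
        _ ≤ _ := by gcongr; exact le_max_left _ _
    · rw [mem_closedBall_zero_iff]
      refine (norm_add_le _ _).trans (add_le_add (hbd _ le_rfl) ?_)
      rw [norm_smul, Real.norm_of_nonneg hα.le]
      gcongr
      exact hb₁ _ (hbd _ le_rfl) _ (M.clock_mem_Omega _ hz)
    · intro t ht
      have ht0 := ht₁.trans ht
      have d1 := (hΘ t ht0).add ((hP.hasDerivWithinAt_solution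
        (ContinuousOn.section h.continuousOn_fG) hz hΘ ht0).const_smul α)
      refine (d1.mono (Ici_subset_Ici.2 ht₁)).congr_deriv ?_
      have e1 : M.f (Θ t) (M.G (M.clock t z)) = M.fG (Θ t) (M.clock t z) := rfl
      have e2 : M.mean M.fG (Θ t) = M.fbar (Θ t) := rfl
      have e3 : fderiv ℝ (fun θ => fhat θ (M.clock t z)) (Θ t) (M.fG (Θ t) (M.clock t z)) =
        -M.Upsilon fhat (Θ t) (M.clock t z) := by rw [Upsilon, neg_neg]
      rw [e1, e2, e3]
      module
    · intro t ht
      have h1 := hL.dist_le_mul (Θ t) (Θ t + α • fhat (Θ t) (M.clock t z))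
      rw [dist_eq_norm, dist_self_add_right, norm_smul, Real.norm_of_nonneg hα.le] at h1
      refine (norm_sub_le _ _).trans ?_
      rw [norm_smul, Real.norm_of_nonneg hα.le]
      have h2 := hb₁ _ (hbd t ht) _ (M.clock_mem_Omega t hz)
      have h3 := hb₂ _ (hbd t ht) _ (M.clock_mem_Omega t hz)
      calc _ ≤ L * (α * C₁) + α * C₂ := by
            refine add_le_add (h1.trans ?_) ?_ <;> gcongr
        _ = c * α := by ring
  -- For large gains cα/ε > 1, and the ultimate bound B + ‖θ*‖ is itself O(α).
  · filter_upwards [eventually_ge_atTop t₁] with t ht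
    have h1 : ‖Θ t - θs‖ ≤ B + ‖θs‖ :=
      (norm_sub_le _ _).trans (by gcongr; exact hbd t ht)
    have h0 : 0 ≤ B + ‖θs‖ := (norm_nonneg _).trans h1
    calc ‖Θ t - θs‖ ≤ (B + ‖θs‖) * 1 := by rw [mul_one]; exact h1
      _ ≤ (B + ‖θs‖) * (c * α / ε) := by
        gcongr
        rw [le_div_iff₀ hε]
        linarith
      _ = (B + ‖θs‖) * c / ε * α := by ring
      _ ≤ _ := by gcongr; exact le_max_right _ _

end QSAModel

/-! ### The slow variable -/

namespace QSAModel

variable {d m K : ℕ} {M : QSAModel d m K}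

local notation "E" => EuclideanSpace ℝ (Fin d)

variable {fhat fhathat Upsilonhat :
  EuclideanSpace ℝ (Fin d) → (Fin K → ℂ) → EuclideanSpace ℝ (Fin d)}

/-- The corrected estimate, whose dynamics are free of `O(α)` oscillations. -/
def slowVariable (fhat fhathat Upsilonhat : E → (Fin K → ℂ) → E)
    (A : E →L[ℝ] E) (α : ℝ) (θ : E) (z : Fin K → ℂ) : E :=
  θ + α • fhat θ z - α ^ 2 • Upsilonhat θ z - α ^ 2 • A (fhathat θ z)

/-- Υ̂ replaces Υ by its mean, and A f̂̂ supplies the term αA f̂ by which A(Y − θ*) differs from A(Θ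
− θ*) at first order. What is left after the factor α is linear dynamics in Y − θ*, the Taylor
remainder of f̄, −αῩ(Θ), and O(α²). -/
theorem StableFamily.exists_eventually_slowVariable_sub_le {α₀ : ℝ} {θs : E}
    (hS : M.StableFamily α₀ θs) (hLip : M.LipschitzFields) (h : M.SmoothFields)
    (hP : M.IsSmoothPoissonSolution M.fG fhat) (hP₂ : M.IsSmoothPoissonSolution fhat fhathat)
    (hPΥ : M.IsSmoothPoissonSolution (M.Upsilon fhat) Upsilonhat) :
    ∃ C : ℝ, 0 < C ∧ ∀ α : ℝ, 0 < α → α ≤ α₀ → ∀ z ∈ M.Omega, ∀ Θ, M.IsSolution α z Θ →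
      ∀ᶠ t in atTop, ‖slowVariable fhat fhathat Upsilonhat (fderiv ℝ M.fbar θs) α (Θ t)
        (M.clock t z) - θs‖ ≤ C * (α ^ 2 + α * ‖M.UpsilonBar fhat θs‖) := by
  set A := fderiv ℝ M.fbar θs
  have hα₀ := hS.pos
  obtain ⟨C₀, hC₀, hnear⟩ := hS.exists_eventually_norm_sub_le hLip h hP
  set B := ‖θs‖ + C₀ * α₀
  have hθsB : ‖θs‖ ≤ B := le_add_of_nonneg_right (by positivity)
  obtain ⟨Q, hQ, hquad⟩ := h.2.exists_norm_sub_fderiv_le θs B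
  obtain ⟨L, hL, hlip⟩ := hP.exists_lipschitz_UpsilonBar h B
  obtain ⟨C₁, hC₁, hb₁⟩ := ContinuousOn.exists_bound_closedBall
    (u := fun θ z => A (Upsilonhat θ z) + A (A (fhathat θ z)) -
      (fderiv ℝ (fun θ => Upsilonhat θ z) θ (M.fG θ z) +
        A (fderiv ℝ (fun θ => fhathat θ z) θ (M.fG θ z)))) M.isCompact_Omega
    (((A.continuous.comp_continuousOn hPΥ.contDiffOn.continuousOn).add
      ((A.continuous.comp A.continuous).comp_continuousOn hP₂.contDiffOn.continuousOn)).sub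
      ((hPΥ.continuousOn_fderiv_fG h).add
        (A.continuous.comp_continuousOn (hP₂.continuousOn_fderiv_fG h)))) B
  obtain ⟨C, hC, hmain⟩ := hS.hurwitz.eventually_norm_le
  -- In order: Taylor remainder, variation of Ῡ between Θ and θ*, corrector remainders, and a 1 for
  -- the term α‖Ῡ(θ*)‖ itself.
  set c := Q * C₀ ^ 2 + L * C₀ + C₁ + 1
  have hc : 0 < c := by positivity
  refine ⟨C * c, by positivity, fun α hα hαα z hz Θ hΘ => ?_⟩
  obtain ⟨t₀, ht₀⟩ := eventually_atTop.1 (hnear α hα hαα z hz Θ hΘ)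
  set t₁ := max t₀ 0
  have ht₁ : 0 ≤ t₁ := le_max_right _ _
  have hcl : ∀ t, t₁ ≤ t → ‖Θ t - θs‖ ≤ C₀ * α := fun t ht => ht₀ t ((le_max_left _ _).trans ht)
  have hbd : ∀ t, t₁ ≤ t → ‖Θ t‖ ≤ B := fun t ht => by
    calc ‖Θ t‖ = ‖θs + (Θ t - θs)‖ := by rw [add_sub_cancel]
      _ ≤ ‖θs‖ + ‖Θ t - θs‖ := norm_add_le _ _
      _ ≤ ‖θs‖ + C₀ * α₀ := by
        gcongr
        exact (hcl t ht).trans (by gcongr)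
  have hres := hmain α (c * (α ^ 2 + α * ‖M.UpsilonBar fhat θs‖)) t₁
    (fun t => slowVariable fhat fhathat Upsilonhat A α (Θ t) (M.clock t z) - θs)
    (fun t => (M.fbar (Θ t) - M.fbar θs - A (Θ t - θs)) - α • M.UpsilonBar fhat (Θ t) +
      α ^ 2 • (A (Upsilonhat (Θ t) (M.clock t z)) + A (A (fhathat (Θ t) (M.clock t z))) -
      (fderiv ℝ (fun θ => Upsilonhat θ (M.clock t z)) (Θ t) (M.fG (Θ t) (M.clock t z)) +
        A (fderiv ℝ (fun θ => fhathat θ (M.clock t z)) (Θ t) (M.fG (Θ t) (M.clock t z))))))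
    hα (by positivity) ?_ ?_
  · simpa only [mul_assoc] using hres
  · intro t ht
    have ht0 := ht₁.trans ht
    have d1 := (hP.hasDerivWithinAt_solution
        (ContinuousOn.section h.continuousOn_fG) hz hΘ ht0).const_smul α
    have d2 := (hPΥ.hasDerivWithinAt_solution
        (ContinuousOn.section (hP.continuousOn_Upsilon h)) hz hΘ ht0).const_smul (α ^ 2)
    have d3 := (A.hasFDerivAt.comp_hasDerivWithinAt t
      (hP₂.hasDerivWithinAt_solution hP.continuousOn hz hΘ ht0)).const_smul (α ^ 2)
    refine ((((((hΘ t ht0).add d1).sub d2).sub d3).sub_const θs).mono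
      (Ici_subset_Ici.2 ht₁)).congr_deriv ?_
    have e1 : M.f (Θ t) (M.G (M.clock t z)) = M.fG (Θ t) (M.clock t z) := rfl
    have e2 : M.mean M.fG (Θ t) = M.fbar (Θ t) := rfl
    have e3 : fderiv ℝ (fun θ => fhat θ (M.clock t z)) (Θ t) (M.fG (Θ t) (M.clock t z)) =
      -M.Upsilon fhat (Θ t) (M.clock t z) := by rw [Upsilon, neg_neg]
    have e4 : M.mean (M.Upsilon fhat) (Θ t) = M.UpsilonBar fhat (Θ t) := rfl
    have e5 : M.fbar θs = 0 := (hS.gas.unique_equilibrium θs).2 rfl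
    rw [e1, e2, e3, e4, e5, hP.mean_zero]
    simp only [slowVariable, map_sub, map_add, map_smul, sub_zero]
    module
  · intro t ht
    have n1 : ‖M.fbar (Θ t) - M.fbar θs - A (Θ t - θs)‖ ≤ Q * C₀ ^ 2 * α ^ 2 := by
      refine (hquad _ (hbd t ht)).trans ?_
      rw [mul_assoc, ← mul_pow]
      gcongr
      exact hcl t ht
    have n2 : ‖α • M.UpsilonBar fhat (Θ t)‖ ≤
        α * ‖M.UpsilonBar fhat θs‖ + L * C₀ * α ^ 2 := by
      rw [norm_smul, Real.norm_of_nonneg hα.le]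
      have h1 := (hlip (Θ t) θs (hbd t ht) hθsB).trans
        (mul_le_mul_of_nonneg_left (hcl t ht) hL.le)
      have h2 : ‖M.UpsilonBar fhat (Θ t)‖ ≤ ‖M.UpsilonBar fhat θs‖ + L * (C₀ * α) := by
        calc ‖M.UpsilonBar fhat (Θ t)‖ =
            ‖M.UpsilonBar fhat θs + (M.UpsilonBar fhat (Θ t) - M.UpsilonBar fhat θs)‖ := by
              rw [add_sub_cancel]
          _ ≤ _ := (norm_add_le _ _).trans (by gcongr)
      calc α * ‖M.UpsilonBar fhat (Θ t)‖ ≤ α * (‖M.UpsilonBar fhat θs‖ + L * (C₀ * α)) := by gcongr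
        _ = _ := by ring
    have n3 := hb₁ _ (hbd t ht) _ (M.clock_mem_Omega t hz)
    refine (norm_add_le _ _).trans ((add_le_add ((norm_sub_le _ _).trans (add_le_add n1 n2))
      (le_of_eq (norm_smul _ _))).trans ?_)
    rw [Real.norm_of_nonneg (by positivity)]
    have n4 := mul_le_mul_of_nonneg_left n3 (sq_nonneg α)
    have n5 : 0 ≤ (Q * C₀ ^ 2 + L * C₀ + C₁) * (α * ‖M.UpsilonBar fhat θs‖) := by positivity
    have n6 : 0 ≤ α ^ 2 := by positivity
    simp only [c]
    linarith

end QSAModel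

/-! ### Energy estimate for the second-order filter -/

section Filter

variable {d : ℕ}

local notation "E" => EuclideanSpace ℝ (Fin d)

/-- The dissipation estimate for the second-order filter in normalized time. -/
theorem secondOrderFilter_dissipation {ζ b : ℝ} (hζ : 0 < ζ) (hζ1 : ζ < 1) {Z U c₁ c₂ : E}
    (h₁ : ‖c₁‖ ≤ b) (h₂ : ‖c₂‖ ≤ 3 * b) :
    2 * inner ℝ Z (U + c₁) + 2 * inner ℝ U (-Z - (2 * ζ) • U + c₂) +
      ζ * (inner ℝ Z (-Z - (2 * ζ) • U + c₂) + inner ℝ (U + c₁) U) ≤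
      -(ζ / 6) * (‖Z‖ ^ 2 + ‖U‖ ^ 2 + ζ * inner ℝ Z U) + 74 * b ^ 2 / ζ := by
  have hb : 0 ≤ b := (norm_nonneg _).trans h₁
  have i1 : inner ℝ Z c₁ ≤ ‖Z‖ * b := (real_inner_le_norm _ _).trans (by gcongr)
  have i2 : inner ℝ U c₂ ≤ ‖U‖ * (3 * b) := (real_inner_le_norm _ _).trans (by gcongr)
  have i3 : inner ℝ Z c₂ ≤ ‖Z‖ * (3 * b) := (real_inner_le_norm _ _).trans (by gcongr)
  have i4 : inner ℝ c₁ U ≤ b * ‖U‖ := (real_inner_le_norm _ _).trans (by gcongr)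
  have i5 := abs_le.1 (abs_real_inner_le_norm Z U)
  simp only [inner_add_right, inner_sub_right, inner_neg_right, inner_add_left,
    real_inner_smul_right, real_inner_self_eq_norm_sq, real_inner_comm Z U]
  set n := ‖Z‖
  set u := ‖U‖
  set q := inner ℝ Z U
  have hn : 0 ≤ n := norm_nonneg _
  have hu : 0 ≤ u := norm_nonneg _
  -- The cross term ζ⟨Z, U⟩ of the energy creates the missing damping of Z. Undisturbed, the
  -- derivative is −ζn² − 3ζu² − 2ζ²q; these weights leave −(ζ/2)n² − ζu², and the disturbances may
  -- use a further ζ/4 of each square.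
  have j0 : -q ≤ (n ^ 2 / 2 + 2 * u ^ 2) / 2 := by nlinarith [sq_nonneg (n - 2 * u)]
  have j1 : ζ * (2 * ζ) * -q ≤ ζ * (n ^ 2 / 2 + 2 * u ^ 2) := by
    have hp : 0 ≤ n ^ 2 / 2 + 2 * u ^ 2 := by positivity
    calc ζ * (2 * ζ) * -q ≤ ζ * (2 * ζ) * ((n ^ 2 / 2 + 2 * u ^ 2) / 2) := by gcongr
      _ = ζ * (n ^ 2 / 2 + 2 * u ^ 2) * ζ := by ring
      _ ≤ ζ * (n ^ 2 / 2 + 2 * u ^ 2) * 1 := by gcongr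
      _ = _ := mul_one _
  have j2 : ζ * q ≤ (n ^ 2 + u ^ 2) / 2 := by
    have : q ≤ (n ^ 2 + u ^ 2) / 2 := by nlinarith [sq_nonneg (n - u)]
    have hp : 0 ≤ (n ^ 2 + u ^ 2) / 2 := by positivity
    nlinarith
  have j3 : 5 * (n * b) ≤ ζ / 4 * n ^ 2 + 25 * b ^ 2 / ζ := by
    have : ζ / 4 * n ^ 2 + 25 * b ^ 2 / ζ - 5 * (n * b) = (ζ * n - 10 * b) ^ 2 / (4 * ζ) := by
      field_simp; ring
    have : 0 ≤ (ζ * n - 10 * b) ^ 2 / (4 * ζ) := by positivity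
    linarith
  have j4 : 7 * (u * b) ≤ ζ / 4 * u ^ 2 + 49 * b ^ 2 / ζ := by
    have : ζ / 4 * u ^ 2 + 49 * b ^ 2 / ζ - 7 * (u * b) = (ζ * u - 14 * b) ^ 2 / (4 * ζ) := by
      field_simp; ring
    have : 0 ≤ (ζ * u - 14 * b) ^ 2 / (4 * ζ) := by positivity
    linarith
  have j5 : ζ * inner ℝ Z c₂ ≤ 3 * (n * b) := by
    have h1 : ζ * inner ℝ Z c₂ ≤ ζ * (n * (3 * b)) := by gcongr
    have h2 : 0 ≤ n * (3 * b) := by positivity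
    nlinarith
  have j6 : ζ * inner ℝ c₁ U ≤ u * b := by
    have h1 : ζ * inner ℝ c₁ U ≤ ζ * (b * u) := by gcongr
    have h2 : 0 ≤ b * u := by positivity
    nlinarith
  have j7 : 74 * b ^ 2 / ζ = 25 * b ^ 2 / ζ + 49 * b ^ 2 / ζ := by ring
  have j8 : ζ / 6 * (n ^ 2 + u ^ 2 + ζ * q) ≤ ζ / 4 * (n ^ 2 + u ^ 2) := by
    have : n ^ 2 + u ^ 2 + ζ * q ≤ 3 / 2 * (n ^ 2 + u ^ 2) := by linarith
    calc ζ / 6 * (n ^ 2 + u ^ 2 + ζ * q) ≤ ζ / 6 * (3 / 2 * (n ^ 2 + u ^ 2)) := by gcongr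
      _ = _ := by ring
  rw [j7]
  nlinarith

/-- The second-order filter suppresses an input `W'` that is the derivative of a small signal, and
passes the rest of the input with bounded gain. -/
theorem IsFilterOutput.eventually_norm_sub_le {γ ζ b t₀ : ℝ} {Θ F W W' : ℝ → E} {θs : E}
    (hF : IsFilterOutput γ ζ Θ F) (hζ : 0 < ζ) (hζ1 : ζ < 1) (hγ : 0 < γ) (hb : 0 < b)
    (ht₀ : 0 ≤ t₀) (hW : ∀ t, t₀ ≤ t → HasDerivWithinAt W (W' t) (Ici t₀) t)
    (hΘ : ∀ t, t₀ ≤ t → ‖Θ t - θs - W' t‖ ≤ b) (hWb : ∀ t, t₀ ≤ t → γ * ‖W t‖ ≤ b) :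
    ∀ᶠ t in atTop, ‖F t - θs‖ ≤ 43 / ζ * b := by
  obtain ⟨V, hV⟩ := hF
  let Z : ℝ → E := fun t => F t - θs
  -- Subtracting γW from the normalized velocity removes W' from the equation: only γW and Θ − θ* −
  -- W' remain as inputs, and both are bounded by b.
  let U : ℝ → E := fun t => γ⁻¹ • V t - γ • W t
  let c₁ : ℝ → E := fun t => γ • W t
  let c₂ : ℝ → E := fun t => Θ t - θs - W' t - (2 * ζ) • (γ • W t)
  have hZ : ∀ t, t₀ ≤ t → HasDerivWithinAt Z (γ • (U t + c₁ t)) (Ici t₀) t := by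
    intro t ht
    refine (((hV t (ht₀.trans ht)).1.mono (Ici_subset_Ici.2 ht₀)).sub_const θs).congr_deriv ?_
    simp only [U, c₁, sub_add_cancel, smul_smul, mul_inv_cancel₀ hγ.ne', one_smul]
  have hU : ∀ t, t₀ ≤ t → HasDerivWithinAt U (γ • (-Z t - (2 * ζ) • U t + c₂ t)) (Ici t₀) t := by
    intro t ht
    refine ((((hV t (ht₀.trans ht)).2.mono (Ici_subset_Ici.2 ht₀)).const_smul γ⁻¹).sub
      ((hW t ht).const_smul γ)).congr_deriv ?_
    simp only [U, Z, c₂]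
    match_scalars <;> field_simp <;> ring
  have hd : ∀ t, t₀ ≤ t → HasDerivWithinAt
      (fun t => ‖Z t‖ ^ 2 + ‖U t‖ ^ 2 + ζ * inner ℝ (Z t) (U t))
      (2 * inner ℝ (Z t) (γ • (U t + c₁ t)) +
        2 * inner ℝ (U t) (γ • (-Z t - (2 * ζ) • U t + c₂ t)) +
        ζ * (inner ℝ (Z t) (γ • (-Z t - (2 * ζ) • U t + c₂ t)) +
          inner ℝ (γ • (U t + c₁ t)) (U t))) (Ici t₀) t := fun t ht =>
    ((hZ t ht).norm_sq.add (hU t ht).norm_sq).add (((hZ t ht).inner ℝ (hU t ht)).const_mul ζ)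
  have hev := eventually_le_of_deriv_right_le (a := γ * (ζ / 6)) (β := γ * (74 * b ^ 2 / ζ))
    (t₀ := t₀) (by positivity) (by positivity) (fun t ht => (hd t ht).continuousWithinAt)
    (fun t ht => (hd t ht).mono (Ici_subset_Ici.2 ht)) (fun t ht => ?_)
  · filter_upwards [hev] with t ht
    have h1 : -(‖Z t‖ * ‖U t‖) ≤ inner ℝ (Z t) (U t) :=
      (abs_le.1 (abs_real_inner_le_norm (Z t) (U t))).1
    have h2 : ‖Z t‖ ^ 2 / 2 ≤ ‖Z t‖ ^ 2 + ‖U t‖ ^ 2 + ζ * inner ℝ (Z t) (U t) := by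
      have h3 : 0 ≤ ‖Z t‖ * ‖U t‖ := by positivity
      have h4 : -(‖Z t‖ * ‖U t‖) ≤ ζ * inner ℝ (Z t) (U t) := by nlinarith
      nlinarith [sq_nonneg (‖Z t‖ - ‖U t‖), sq_nonneg ‖U t‖]
    -- 888 = 2·74·6, and the energy is at least ‖Z‖²/2, so ‖Z‖² ≤ 1776(b/ζ)² ≤ (43b/ζ)².
    have h3 : 2 * (γ * (74 * b ^ 2 / ζ) / (γ * (ζ / 6))) = 888 * (b / ζ) ^ 2 := by
      field_simp; norm_num
    rw [h3] at ht
    refine le_of_abs_le (abs_le_of_sq_le_sq ?_ (by positivity))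
    have h4 : (43 / ζ * b) ^ 2 = 1849 * (b / ζ) ^ 2 := by ring
    have h5 : 0 ≤ (b / ζ) ^ 2 := by positivity
    rw [h4]
    change ‖Z t‖ ^ 2 ≤ _
    linarith
  · have b1 : ‖c₁ t‖ ≤ b := by
      rw [norm_smul, Real.norm_of_nonneg hγ.le]
      exact hWb t ht
    have b2 : ‖c₂ t‖ ≤ 3 * b := by
      refine (norm_sub_le _ _).trans ?_
      have : ‖(2 * ζ) • (γ • W t)‖ ≤ 2 * b := by
        rw [norm_smul, Real.norm_of_nonneg (by positivity)]
        have : ‖γ • W t‖ ≤ b := b1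
        nlinarith [norm_nonneg (γ • W t)]
      linarith [hΘ t ht]
    have := secondOrderFilter_dissipation hζ hζ1 (Z := Z t) (U := U t) b1 b2
    simp only [real_inner_smul_right, real_inner_smul_left]
    nlinarith

end Filter

/-! ### Bias of the filtered estimates and conclusion -/

namespace QSAModel

variable {d m K : ℕ} {M : QSAModel d m K}

local notation "E" => EuclideanSpace ℝ (Fin d)

/-- Ultimate bound on the bias of the filtered estimates. -/
theorem StableFamily.exists_eventually_filter_sub_le {α₀ : ℝ} {θs : E}
    {fhat : EuclideanSpace ℝ (Fin d) → (Fin K → ℂ) → EuclideanSpace ℝ (Fin d)}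
    (hS : M.StableFamily α₀ θs) (hLip : M.LipschitzFields) (h : M.SmoothFields)
    (hP : M.PoissonSolvable fhat) {ζ : ℝ} (hζ : 0 < ζ) (hζ1 : ζ < 1) :
    ∃ C : ℝ, 0 < C ∧ ∀ α γ : ℝ, 0 < α → α ≤ α₀ → 0 < γ → ∀ z ∈ M.Omega, ∀ Θ, M.IsSolution α z Θ →
      ∀ F, IsFilterOutput γ ζ Θ F →
        ∀ᶠ t in atTop, ‖F t - θs‖ ≤ C * (α * γ + α ^ 2) + C * (α * ‖M.UpsilonBar fhat θs‖) := by
  obtain ⟨hP, ⟨fhathat, hP₂⟩, Upsilonhat, hPΥ⟩ := hP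
  obtain ⟨C₀, hC₀, hslow⟩ := hS.exists_eventually_slowVariable_sub_le hLip h hP hP₂ hPΥ
  set A := fderiv ℝ M.fbar θs
  obtain ⟨B, hB⟩ := hS.ultimatelyBounded
  obtain ⟨C₁, hC₁, hb₁⟩ := ContinuousOn.exists_bound_closedBall
    (u := fun θ z => Upsilonhat θ z + A (fhathat θ z) -
      fderiv ℝ (fun θ => fhathat θ z) θ (M.fG θ z)) M.isCompact_Omega
    ((hPΥ.contDiffOn.continuousOn.add
      (A.continuous.comp_continuousOn hP₂.contDiffOn.continuousOn)).sub
      (hP₂.continuousOn_fderiv_fG h)) B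
  obtain ⟨C₂, hC₂, hb₂⟩ := ContinuousOn.exists_bound_closedBall M.isCompact_Omega
    hP₂.contDiffOn.continuousOn B
  set c := C₀ + C₁ + C₂
  refine ⟨43 / ζ * c, by positivity, fun α γ hα hαα hγ z hz Θ hΘ F hF => ?_⟩
  obtain ⟨t₀, ht₀⟩ := hB α hα hαα z hz Θ hΘ
  obtain ⟨t₁, ht₁⟩ := eventually_atTop.1 (hslow α hα hαα z hz Θ hΘ)
  set t₂ := max (max t₀ t₁) 0
  have ht₂ : 0 ≤ t₂ := le_max_right _ _
  have hbd : ∀ t, t₂ ≤ t → ‖Θ t‖ ≤ B := fun t ht =>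
    ht₀ t (((le_max_left _ _).trans (le_max_left _ _)).trans ht) (ht₂.trans ht)
  have hsl := fun t (ht : t₂ ≤ t) => ht₁ t (((le_max_right _ _).trans (le_max_left _ _)).trans ht)
  set υ := ‖M.UpsilonBar fhat θs‖
  have hυ : 0 ≤ υ := norm_nonneg _
  -- W = α f̂̂ has derivative −α f̂ + O(α²) because f̂ has mean zero, so subtracting W' from Θ − θ*
  -- leaves the slow variable's deviation and O(α²), while γ‖W‖ = O(αγ).
  have hres := hF.eventually_norm_sub_le (θs := θs)
    (b := c * (α * γ + α ^ 2 + α * υ)) (t₀ := t₂)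
    (W := fun t => α • fhathat (Θ t) (M.clock t z))
    (W' := fun t => α • (α • fderiv ℝ (fun θ => fhathat θ (M.clock t z)) (Θ t)
      (M.fG (Θ t) (M.clock t z)) - fhat (Θ t) (M.clock t z)))
    hζ hζ1 hγ (by positivity) ht₂ ?_ ?_ ?_
  · filter_upwards [hres] with t ht
    refine ht.trans (le_of_eq ?_)
    ring
  · intro t ht
    refine (((hP₂.hasDerivWithinAt_solution hP.continuousOn hz hΘ
      (ht₂.trans ht)).const_smul α).mono (Ici_subset_Ici.2 ht₂)).congr_deriv ?_
    rw [hP.mean_zero, sub_zero]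
  · intro t ht
    have e : Θ t - θs - α • (α • fderiv ℝ (fun θ => fhathat θ (M.clock t z)) (Θ t)
        (M.fG (Θ t) (M.clock t z)) - fhat (Θ t) (M.clock t z)) =
        (slowVariable fhat fhathat Upsilonhat A α (Θ t) (M.clock t z) - θs) +
          α ^ 2 • (Upsilonhat (Θ t) (M.clock t z) + A (fhathat (Θ t) (M.clock t z)) -
            fderiv ℝ (fun θ => fhathat θ (M.clock t z)) (Θ t) (M.fG (Θ t) (M.clock t z))) := by
      rw [slowVariable]
      module
    rw [e]
    refine (norm_add_le _ _).trans ?_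
    rw [norm_smul, Real.norm_of_nonneg (by positivity : 0 ≤ α ^ 2)]
    have h1 := hsl t ht
    have h2 := mul_le_mul_of_nonneg_left (hb₁ _ (hbd t ht) _ (M.clock_mem_Omega t hz))
      (sq_nonneg α)
    calc _ ≤ C₀ * (α ^ 2 + α * υ) + α ^ 2 * C₁ := add_le_add h1 h2
      _ ≤ C₀ * (α * γ + α ^ 2 + α * υ) + C₁ * (α * γ + α ^ 2 + α * υ) +
          C₂ * (α * γ + α ^ 2 + α * υ) := by
        have p1 : 0 ≤ C₀ * (α * γ) := by positivity
        have p2 : 0 ≤ C₁ * (α * γ + α * υ) := by positivity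
        have p3 : 0 ≤ C₂ * (α * γ + α ^ 2 + α * υ) := by positivity
        linarith
      _ = _ := by ring
  · intro t ht
    rw [norm_smul, Real.norm_of_nonneg hα.le]
    have h1 := hb₂ _ (hbd t ht) _ (M.clock_mem_Omega t hz)
    calc γ * (α * ‖fhathat (Θ t) (M.clock t z)‖) ≤ γ * (α * C₂) := by gcongr
      _ = C₂ * (α * γ) := by ring
      _ ≤ c * (α * γ + α ^ 2 + α * υ) := by
        refine mul_le_mul ?_ ?_ (by positivity) (by positivity)
        · simp only [c]; linarith
        · have : 0 ≤ α ^ 2 + α * υ := by positivity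
          linarith

end QSAModel

theorem LeUpToVanishing.of_eventually_le {u : ℝ → ℝ} {b : ℝ} (h : ∀ᶠ t in atTop, u t ≤ b) :
    LeUpToVanishing u b := by
  refine ⟨fun t => max (u t - b) 0, ?_, fun t _ => by linarith [le_max_left (u t - b) 0]⟩
  refine tendsto_const_nhds.congr' ?_
  filter_upwards [h] with t ht
  rw [max_eq_right (by linarith)]

theorem mainTheorem2 {d m K : ℕ} (M : QSAModel d m K)
    (fhat : EuclideanSpace ℝ (Fin d) → (Fin K → ℂ) → EuclideanSpace ℝ (Fin d))
    (α₀ : ℝ) (θs : EuclideanSpace ℝ (Fin d))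
    (hLip : M.LipschitzFields) (hSmooth : M.SmoothFields)
    (hPoisson : M.PoissonSolvable fhat) (hStable : M.StableFamily α₀ θs) :
    (∃ C : ℝ, ∀ α : ℝ, 0 < α → α ≤ α₀ → ∀ z ∈ M.Omega, ∀ Θ, M.IsSolution α z Θ →
      LeUpToVanishing (fun t => ‖Θ t - θs‖) (C * α)) ∧
    (∀ ζ η : ℝ, 0 < ζ → ζ < 1 → 0 < η →
      (∃ C₁ C₂ : ℝ, ∀ α γ : ℝ, 0 < α → α ≤ α₀ → γ = η * α →
        ∀ z ∈ M.Omega, ∀ Θ, M.IsSolution α z Θ → ∀ F, IsFilterOutput γ ζ Θ F →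
          LeUpToVanishing (fun t => ‖F t - θs‖)
            (C₁ * (α * γ + α ^ 2) + C₂ * (α * ‖M.UpsilonBar fhat θs‖))) ∧
      (M.UpsilonBar fhat θs = 0 →
        ∃ B₀ : ℝ, ∀ α γ : ℝ, 0 < α → α ≤ α₀ → γ = η * α →
          ∀ z ∈ M.Omega, ∀ Θ, M.IsSolution α z Θ → ∀ F, IsFilterOutput γ ζ Θ F →
            limsup (fun t => ‖F t - θs‖ₑ) atTop ≤ ENNReal.ofReal (B₀ * α ^ 2))) := by
  refine ⟨?_, fun ζ η hζ hζ1 hη => ?_⟩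
  · obtain ⟨C, -, hC⟩ := hStable.exists_eventually_norm_sub_le hLip hSmooth hPoisson.1
    exact ⟨C, fun α hα hαα z hz Θ hΘ => .of_eventually_le (hC α hα hαα z hz Θ hΘ)⟩
  obtain ⟨C, -, hC⟩ := hStable.exists_eventually_filter_sub_le hLip hSmooth hPoisson hζ hζ1
  -- With γ = ηα one has αγ + α² = (η + 1)α², which gives the constant for (iii).
  refine ⟨⟨C, C, fun α γ hα hαα hγ z hz Θ hΘ F hF => .of_eventually_le
    (hC α γ hα hαα (by rw [hγ]; positivity) z hz Θ hΘ F hF)⟩, fun hΥ => ⟨C * (η + 1), ?_⟩⟩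
  intro α γ hα hαα hγ z hz Θ hΘ F hF
  refine limsup_le_of_le (by isBoundedDefault) ?_
  filter_upwards [hC α γ hα hαα (by rw [hγ]; positivity) z hz Θ hΘ F hF] with t ht
  rw [← ofReal_norm]
  refine ENNReal.ofReal_le_ofReal (ht.trans (le_of_eq ?_))
  rw [hΥ, norm_zero, hγ]
  ring
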